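/- Identify $\mathbb{R}^2$ with $\mathbb{C}$ and write $z^\perp=(-z_2,z_1)$, $z^*=z/|z|^2$, $\Delta=\{|z|>1\}$, $\operatorname{curl}v=\partial_1v_2-\partial_2v_1$. Let $\mathcal C\subset\mathbb{R}^2$ be a connected compact set of positive Sobolev $H^1$ capacity, $\Omega=\mathbb{R}^2\setminus\mathcal C$, $\Pi$ the unbounded connected component of $\Omega$, and $\mathcal T:\Pi\to\Delta$ the biholomorphism with $\mathcal T(z)\sim\lambda z$ as $|z|\to\infty$ for some $\lambda>0$. Let $p\in(2,\infty]$ and let $R_0$ be such that $\mathcal C\subset B(0,R_0)$ (open ball). Then, the obstacle $\mathcal C$ being fixed, there is a constant $C_0=C_0(\|\omega^0\|_{L^1},\|\omega^0\|_{L^p},R_0,p)$, depending on nothing else, with the following property. Let * $\omega^0\in L^1\cap L^p(\Omega)$, with norms $\|\omega^0\|_{L^1}$, $\|\omega^0\|_{L^p}$ taken on $\Omega$; * $(O_n)$ be smooth Jordan domains (bounded domains enclosed by smooth regular simple closed curves) whose closures $\overline{O_n}$ converge to $\mathcal C$ in the Hausdorff distance, $\Omega_n=\mathbb{R}^2\setminus\overline{O_n}$,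 and $\mathcal T_n:\Omega_n\to\Delta$ the biholomorphism with $\mathcal T_n(z)\sim\lambda_n z$ at infinity for some $\lambda_n>0$; * $\omega^0_n\in C^\infty_c(\Omega_n)$ with $\|\omega^0_n\|_{L^1}\le\|\omega^0\|_{L^1}$ and $\|\omega^0_n\|_{L^p}\le\|\omega^0\|_{L^p}$ for all $n$; * $u_n$ be a smooth (up to the boundary) solution on $[0,\infty)\times\Omega_n$ of the incompressible Euler equations $\partial_tu_n+u_n\cdot\nabla u_n+\nabla q_n=0$, $\operatorname{div}u_n=0$, tangent to $\partial\Omega_n$, with $u_n(t,x)\to0$ as $|x|\to\infty$ locally uniformly in $t\ge0$, and with $\operatorname{curl}u_n(0,\cdot)=\omega^0_n$ in $\Omega_n$; let $\omega_n=\operatorname{curl}u_n$, extended by $0$ outside $\Omega_n$. Then, for every $n$, the function $$f_n(t,x)=\frac1{2\pi}D\mathcal T(x)^T\int_\Pi\Bigl(\frac{\mathcal T(x)-\mathcal T(y)}{|\mathcal T(x)-\mathcal T(y)|^2}-\frac{\mathcal T(x)-\mathcal T(y)^*}{|\mathcal T(x)-\mathcal T(y)^*|^2}\Bigr)^{\perp}\omega_n(t,y)\,dy$$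 is given by an absolutely convergent integral and satisfies $|f_n(t,x)|\le C_0$ for all $t\ge0$ and all $x\notin B(0,R_0)$. Moreover, for every compact set $K$ disjoint from $\overline{B(0,R_0)}$ there is $N_K$ such that for all $n\ge N_K$ one has $K\subset\Omega_n$ and the function $$\nabla^\perp\psi^0_n(t,x)=\frac1{2\pi}D\mathcal T_n(x)^T\int_{\Omega_n}\Bigl(\frac{\mathcal T_n(x)-\mathcal T_n(y)}{|\mathcal T_n(x)-\mathcal T_n(y)|^2}-\frac{\mathcal T_n(x)-\mathcal T_n(y)^*}{|\mathcal T_n(x)-\mathcal T_n(y)^*|^2}\Bigr)^{\perp}\omega_n(t,y)\,dy$$ is given by an absolutely convergent integral and satisfies $|\nabla^\perp\psi^0_n(t,x)|\le 2C_0+1$ for all $t\ge0$ and $x\in K$. -/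

import Mathlib

open Set Filter Topology MeasureTheory
open scoped ENNReal ContDiff

noncomputable section

namespace ExteriorEuler

/-! The plane `ℝ²` is identified with `ℂ`: a vector `(a, b)` is `a + b i`, Lebesgue measure is
`volume`, and real derivatives are `fderiv ℝ`. -/

/-! ### Sobolev capacity -/

/-- `g` is the weak gradient of `v` on the plane. -/
def HasWeakGradient (v : ℂ → ℝ) (g : ℂ → ℂ) : Prop :=
  ∀ φ : ℂ → ℝ, ContDiff ℝ ∞ φ → HasCompactSupport φ → ∀ e : ℂ,
    ∫ x, v x * fderiv ℝ φ x e = - ∫ x, inner ℝ (g x) e * φ x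

/-- The `H¹(ℝ²)` capacity of `E`: the infimum of `‖v‖²_{H¹}` over all `v ∈ H¹(ℝ²)` with `v ≥ 1`
almost everywhere on a neighbourhood of `E`. -/
def sobolevCapacity (E : Set ℂ) : ℝ≥0∞ :=
  sInf {c | ∃ (v : ℂ → ℝ) (g : ℂ → ℂ) (U : Set ℂ),
    MemLp v 2 volume ∧ MemLp g 2 volume ∧ HasWeakGradient v g ∧
    IsOpen U ∧ E ⊆ U ∧ (∀ᵐ x ∂(volume.restrict U), 1 ≤ v x) ∧
    c = eLpNorm v 2 volume ^ 2 + eLpNorm g 2 volume ^ 2}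

/-! ### Domains and conformal maps -/

/-- `O` is the bounded domain enclosed by a smooth regular simple closed curve. -/
def IsSmoothJordanDomain (O : Set ℂ) : Prop :=
  IsOpen O ∧ IsConnected O ∧ Bornology.IsBounded O ∧
  ∃ γ : ℝ → ℂ, ContDiff ℝ ∞ γ ∧ Function.Periodic γ 1 ∧ InjOn γ (Ico 0 1) ∧
    (∀ s, deriv γ s ≠ 0) ∧ frontier O = range γ

/-- The union of the unbounded connected components of `U`. When the complement of `U` is bounded
there is exactly one such component. -/
def unboundedComponent (U : Set ℂ) : Set ℂ :=
  {z | z ∈ U ∧ ¬ Bornology.IsBounded (connectedComponentIn U z)}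

/-- `T` restricted to `U` is a biholomorphism onto `{|z| > 1}` with `T(∞) = ∞` and `T'(∞) > 0`,
that is `T(z) ∼ l z` at infinity for some `l > 0`. The values of `T` off `U` are irrelevant. -/
structure IsExteriorRiemannMap (U : Set ℂ) (T : ℂ → ℂ) : Prop where
  holo : DifferentiableOn ℂ T U
  bij : BijOn T U {z | 1 < ‖z‖}
  infinity : ∃ l : ℝ, 0 < l ∧ Tendsto (fun z => T z / z) (Bornology.cobounded ℂ) (𝓝 (l : ℂ))

/-! ### The Biot-Savart law -/

/-- `z^⊥ = (-z₂, z₁)`. -/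
def perp (z : ℂ) : ℂ := Complex.I * z

/-- `z^* = z / |z|²`. -/
def circleInv (z : ℂ) : ℂ := (‖z‖ ^ 2)⁻¹ • z

/-- The integrand
`((T x - T y)/|T x - T y|² - (T x - (T y)^*)/|T x - (T y)^*|²)^⊥ w(y)`. -/
def biotSavartIntegrand (T : ℂ → ℂ) (w : ℂ → ℝ) (x y : ℂ) : ℂ :=
  w y • perp ((‖T x - T y‖ ^ 2)⁻¹ • (T x - T y)
    - (‖T x - circleInv (T y)‖ ^ 2)⁻¹ • (T x - circleInv (T y)))

/-- `(1/2π) DT(x)ᵀ ∫_U (…)^⊥ w(y) dy`; the transpose of the real Jacobian matrix is the adjoint of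
the real derivative. -/
def biotSavart (U : Set ℂ) (T : ℂ → ℂ) (w : ℂ → ℝ) (x : ℂ) : ℂ :=
  (1 / (2 * Real.pi)) •
    (ContinuousLinearMap.adjoint (fderiv ℝ T x)) (∫ y in U, biotSavartIntegrand T w x y)

/-! ### Smooth Euler flows -/

/-- `∂₁ v₂ - ∂₂ v₁`. -/
def curl (v : ℂ → ℂ) (x : ℂ) : ℝ := (fderiv ℝ v x 1).im - (fderiv ℝ v x Complex.I).re

/-- `∂₁ v₁ + ∂₂ v₂`. -/
def divergence (v : ℂ → ℂ) (x : ℂ) : ℝ := (fderiv ℝ v x 1).re + (fderiv ℝ v x Complex.I).im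

/-- `f ∈ C^∞([0,∞) × closure Ω)`: `f` is there the restriction of a smooth function. -/
def SmoothUpToBoundary {E : Type*} [NormedAddCommGroup E] [NormedSpace ℝ E]
    (Ω : Set ℂ) (f : ℝ → ℂ → E) : Prop :=
  ∃ F : ℝ × ℂ → E, ContDiff ℝ ∞ F ∧ ∀ t, 0 ≤ t → ∀ x ∈ closure Ω, f t x = F (t, x)

/-- `u` is a smooth global solution of the incompressible Euler equations in `Ω` (for some smooth
pressure `q`), tangent to the boundary, vanishing at infinity, with initial vorticity `ω₀`. -/
structure IsSmoothEulerFlow (Ω : Set ℂ) (ω₀ : ℂ → ℝ) (u : ℝ → ℂ → ℂ) : Prop where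
  smooth : SmoothUpToBoundary Ω u
  momentum : ∃ q : ℝ → ℂ → ℝ, SmoothUpToBoundary Ω q ∧ ∀ t, 0 < t → ∀ x ∈ Ω,
    deriv (fun s => u s x) t + fderiv ℝ (u t) x (u t x) + gradient (q t) x = 0
  div_free : ∀ t, 0 ≤ t → ∀ x ∈ Ω, divergence (u t) x = 0
  /-- Impermeability, in the form `∫_Ω u · ∇φ = 0` for all test functions on the plane (not
  required to vanish on the boundary). For a divergence-free `u` that is smooth up to a smooth
  boundary this says that `u · ν = 0` there. -/
  tangent : ∀ t, 0 ≤ t → ∀ φ : ℂ → ℝ, ContDiff ℝ ∞ φ → HasCompactSupport φ →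
    ∫ x in Ω, fderiv ℝ φ x (u t x) = 0
  /-- `u(t, x) → 0` as `|x| → ∞`, locally uniformly in time. -/
  decay : ∀ τ : ℝ, ∀ ε > 0, ∃ R : ℝ, ∀ t ∈ Icc 0 τ, ∀ x ∈ Ω, R ≤ ‖x‖ → ‖u t x‖ ≤ ε
  initial : ∀ x ∈ Ω, curl (u 0) x = ω₀ x

/-- The vorticity of `u` at time `t`, extended by zero outside `Ω`. -/
def vorticity (Ω : Set ℂ) (u : ℝ → ℂ → ℂ) (t : ℝ) : ℂ → ℝ := Ω.indicator (curl (u t))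

end ExteriorEuler

end

namespace ExteriorEuler

/-! ### Univalent functions -/

/-! The estimate is uniform over all exterior Riemann maps whose obstacle lies in a fixed disk of
radius `r < R₀` and contains two points at distance at least `d > 0`. The limit obstacle and, for
large `n`, the approximate ones all belong to such a class, so no convergence of the maps `Tn n` is
needed: one constant serves both bounds.

Complex analysis. If `S` inverts `T`, the function `w (S (1/w) - q)` with `q` in the obstacle is
holomorphic and nonvanishing on the unit disk, and bounded by the maximum principle
(`IsExteriorInverse.norm_diskInverse_le`). This gives `|z - q| ≤ r |T z|`, so `T x` stays at a
definite distance from the unit circle when `|x| ≥ R₀`. A Harnack inequality for nonvanishing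
functions, together with the two separated points, bounds the derivative of `T` at infinity from
above, and then `|T z| / |z|` and `|T'|` away from the obstacle (`exists_forall_norm_deriv_le`).
Since `S` is Lipschitz off a neighbourhood of the unit circle, the kernel is at most a constant
times `|x - y|⁻¹ + 1` (`exists_forall_norm_biotSavartIntegrand_le`).

Fluid mechanics. The vorticity is transported by a divergence-free field tangent to the boundary, so
its distribution function does not increase. This is proved without a flow map, by integrating
functions of the vorticity against a cutoff that shrinks faster than the fluid moves
(`measure_lt_abs_spaceCurl_le`). Hence every Lebesgue norm stays below its initial value.

Finally `|x|⁻¹` is locally in `L^q` for `q < 2`, so Hölder's inequality bounds the singular integral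
by the `L¹` and `Lᵖ` norms (`exists_forall_lintegral_mul_inv_le`). -/

theorem not_eventually_const_of_injOn {U : Set ℂ} (hU : IsOpen U) {f : ℂ → ℂ} (hf : InjOn f U)
    {z : ℂ} (hz : z ∈ U) (b : ℂ) : ¬ ∀ᶠ y in 𝓝 z, f y = b := by
  intro h
  have h1 : ∀ᶠ y in 𝓝[≠] z, f y = b := h.filter_mono nhdsWithin_le_nhds
  have h2 : ∀ᶠ y in 𝓝[≠] z, y ∈ U := (hU.mem_nhds hz |> eventually_mem_set.2).filter_mono
    nhdsWithin_le_nhds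
  obtain ⟨y, ⟨hy1, hy2⟩, hy3⟩ := ((h1.and h2).and self_mem_nhdsWithin).exists
  exact hy3 (hf hy2 hz (hy1.trans h.self_of_nhds.symm))

theorem nhds_le_map_nhds_of_injOn {U : Set ℂ} (hU : IsOpen U) {f : ℂ → ℂ}
    (hd : DifferentiableOn ℂ f U) (hf : InjOn f U) {z : ℂ} (hz : z ∈ U) :
    𝓝 (f z) ≤ map f (𝓝 z) :=
  ((hd.analyticAt (hU.mem_nhds hz)).eventually_constant_or_nhds_le_map_nhds).resolve_left
    (not_eventually_const_of_injOn hU hf hz _)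

/-- The inverse of an injective holomorphic function is holomorphic. -/
theorem differentiableAt_leftInverse_of_injOn {U : Set ℂ} (hU : IsOpen U) {f g : ℂ → ℂ}
    (hd : DifferentiableOn ℂ f U) (hf : InjOn f U) (hg : ∀ z ∈ U, g (f z) = z) {z : ℂ}
    (hz : z ∈ U) : DifferentiableAt ℂ g (f z) := by
  have hcont : ∀ z ∈ U, ContinuousAt g (f z) := by
    intro z hz
    have h : Tendsto g (map f (𝓝 z)) (𝓝 z) := by
      rw [tendsto_map'_iff]
      refine tendsto_id.congr' ?_
      filter_upwards [hU.mem_nhds hz] with y hy using (hg y hy).symm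
    rw [ContinuousAt, hg z hz]
    exact h.mono_left (nhds_le_map_nhds_of_injOn hU hd hf hz)
  have himg : ∀ z ∈ U, f '' U ∈ 𝓝 (f z) := fun z hz =>
    nhds_le_map_nhds_of_injOn hU hd hf hz (image_mem_map (hU.mem_nhds hz))
  have hreg : ∀ z ∈ U, deriv f z ≠ 0 → DifferentiableAt ℂ g (f z) := by
    intro z hz h0
    refine (HasDerivAt.of_local_left_inverse (f := f) (f' := deriv f z) (hcont z hz) ?_ h0
      ?_).differentiableAt
    · rw [hg z hz]
      exact (hd.differentiableAt (hU.mem_nhds hz)).hasDerivAt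
    · filter_upwards [himg z hz] with y hy
      obtain ⟨x, hx, rfl⟩ := hy
      rw [hg x hx]
  have hA : AnalyticAt ℂ (deriv f) z := (hd.analyticAt (hU.mem_nhds hz)).deriv
  have hne : ∀ᶠ y in 𝓝[≠] z, deriv f y ≠ 0 := by
    refine hA.eventually_eq_zero_or_eventually_ne_zero.resolve_left fun h0 => ?_
    obtain ⟨ε, hε, hball⟩ := Metric.eventually_nhds_iff_ball.1
      (h0.and (eventually_mem_set.2 (hU.mem_nhds hz)))
    refine not_eventually_const_of_injOn hU hf hz (f z) ?_
    filter_upwards [Metric.ball_mem_nhds z hε] with y hy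
    refine (convex_ball z ε).is_const_of_fderivWithin_eq_zero (𝕜 := ℂ) (f := f)
      (hd.mono fun w hw => (hball w hw).2) (fun w hw => ?_) hy (Metric.mem_ball_self hε)
    rw [fderivWithin_of_isOpen Metric.isOpen_ball hw]
    ext
    simpa using (hball w hw).1
  -- Zeros of `f'` are isolated, so `g` is differentiable on a punctured neighbourhood of `f z`. It
  -- is continuous there, and the singularity is removable, which avoids proving that `f'` never
  -- vanishes.
  refine (Complex.analyticAt_of_differentiable_on_punctured_nhds_of_continuousAt ?_
    (hcont z hz)).differentiableAt
  have h1 : ∀ᶠ y in 𝓝 z, y ≠ z → deriv f y ≠ 0 := eventually_nhdsWithin_iff.1 hne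
  have h2 := nhds_le_map_nhds_of_injOn hU hd hf hz
    (image_mem_map (h1.and (eventually_mem_set.2 (hU.mem_nhds hz))))
  refine eventually_nhdsWithin_iff.2 ?_
  filter_upwards [h2] with w hw hne
  obtain ⟨y, ⟨hy1, hy2⟩, rfl⟩ := hw
  exact hreg y hy2 (hy1 fun h => hne (by simp [h]))

/-- Lower Harnack inequality for the modulus of a bounded nonvanishing holomorphic function. -/
theorem norm_mul_exp_le_of_ne_zero {f : ℂ → ℂ} {c z : ℂ} {R B κ : ℝ} (hR : 0 < R)
    (hf : DifferentiableOn ℂ f (Metric.ball c R)) (h0 : ∀ w ∈ Metric.ball c R, f w ≠ 0)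
    (hB : ∀ w ∈ Metric.ball c R, ‖f w‖ ≤ B) (hc : ‖f c‖ < B) (hκ : κ < 1)
    (hz : ‖z - c‖ ≤ κ * R) :
    ‖f c‖ * Real.exp (-(2 * κ / (1 - κ) * Real.log (B / ‖f c‖))) ≤ ‖f z‖ := by
  have hcm : c ∈ Metric.ball c R := Metric.mem_ball_self hR
  have hfc : 0 < ‖f c‖ := norm_pos_iff.2 (h0 c hcm)
  have hM : 0 < Real.log (B / ‖f c‖) := Real.log_pos ((one_lt_div hfc).2 hc)
  have hzR : ‖z - c‖ < R := hz.trans_lt (by nlinarith)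
  have hzm : z ∈ Metric.ball c R := by rwa [mem_ball_iff_norm]
  -- `F` is a primitive of `f'/f`, so `F - F c` is a logarithm of `f / f c` with real part at most
  -- `log (B / ‖f c‖)`; Borel–Carathéodory turns this one-sided bound into a bound on its modulus.
  obtain ⟨F, hF⟩ := ((hf.deriv Metric.isOpen_ball).div hf h0).isExactOn_ball
  have hconst : ∀ w ∈ Metric.ball c R, f w * Complex.exp (-(F w)) = f c * Complex.exp (-(F c)) := by
    intro w hw
    have hder : ∀ w ∈ Metric.ball c R,
        HasDerivAt (fun w => f w * Complex.exp (-(F w))) 0 w := by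
      intro w hw
      have h1 := (hf.differentiableAt (Metric.isOpen_ball.mem_nhds hw)).hasDerivAt
      have h2 := h1.mul (hF w hw).neg.cexp
      refine h2.congr_deriv ?_
      have := h0 w hw
      simp only [Pi.div_apply, Pi.neg_apply]
      field_simp
      ring
    refine (convex_ball c R).is_const_of_fderivWithin_eq_zero (𝕜 := ℂ)
      (f := fun w => f w * Complex.exp (-(F w)))
      (fun w hw => (hder w hw).differentiableAt.differentiableWithinAt) (fun w hw => ?_) hw hcm
    rw [fderivWithin_of_isOpen Metric.isOpen_ball hw, ← toSpanSingleton_deriv, (hder w hw).deriv]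
    simp
  have hexp : ∀ w ∈ Metric.ball c R, f w = f c * Complex.exp (F w - F c) := by
    intro w hw
    have := hconst w hw
    rw [Complex.exp_sub]
    rw [Complex.exp_neg, Complex.exp_neg] at this
    have e1 := Complex.exp_ne_zero (F w)
    have e2 := Complex.exp_ne_zero (F c)
    field_simp at this ⊢
    exact this
  have hnorm : ∀ w ∈ Metric.ball c R, ‖f w‖ = ‖f c‖ * Real.exp ((F w - F c).re) := by
    intro w hw
    rw [hexp w hw, norm_mul, Complex.norm_exp]
  have hmem : ∀ w ∈ Metric.ball (0 : ℂ) R, w + c ∈ Metric.ball c R := by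
    intro w hw
    simpa [mem_ball_iff_norm] using hw
  have hBC := Complex.borelCaratheodory_zero (f := fun w => F (w + c) - F c) (R := R) (z := z - c)
    hM ?_ ?_ hR (by simpa [mem_ball_iff_norm] using hzR) (by simp)
  · simp only [sub_add_cancel] at hBC
    rw [hnorm z hzm]
    gcongr
    have h1 : -‖F z - F c‖ ≤ (F z - F c).re := (abs_le.1 (Complex.abs_re_le_norm _)).1
    refine le_trans (neg_le_neg (hBC.trans ?_)) h1
    rw [div_mul_eq_mul_div, div_le_div_iff₀ (by linarith) (by linarith)]
    have : ‖z - c‖ * (1 - κ) ≤ κ * (R - ‖z - c‖) := by nlinarith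
    calc 2 * Real.log (B / ‖f c‖) * ‖z - c‖ * (1 - κ)
        = 2 * Real.log (B / ‖f c‖) * (‖z - c‖ * (1 - κ)) := by ring
      _ ≤ 2 * Real.log (B / ‖f c‖) * (κ * (R - ‖z - c‖)) := by gcongr
      _ = _ := by ring
  · intro w hw
    exact ((hF _ (hmem w hw)).comp_add_const w c).differentiableAt.sub_const _
      |>.differentiableWithinAt
  · intro w hw
    have h1 := hnorm _ (hmem w hw)
    have h2 := hB _ (hmem w hw)
    rw [h1] at h2
    simp only [mem_ofPred_eq]
    rw [Real.le_log_iff_exp_le (div_pos (hfc.trans hc) hfc), le_div_iff₀ hfc]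
    linarith

/-! ### Exterior Riemann maps -/

/-- `S` is the inverse of the exterior Riemann map `T`, and `l` the derivative of `T` at infinity. -/
structure IsExteriorInverse (U : Set ℂ) (T S : ℂ → ℂ) (l : ℝ) : Prop where
  pos : 0 < l
  left_inv : ∀ z ∈ U, S (T z) = z
  maps : ∀ ζ : ℂ, 1 < ‖ζ‖ → S ζ ∈ U
  right_inv : ∀ ζ : ℂ, 1 < ‖ζ‖ → T (S ζ) = ζ
  holo : ∀ ζ : ℂ, 1 < ‖ζ‖ → DifferentiableAt ℂ S ζ
  tendsto : Tendsto (fun z => T z / z) (Bornology.cobounded ℂ) (𝓝 (l : ℂ))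
  tendsto_symm : Tendsto (fun ζ => S ζ / ζ) (Bornology.cobounded ℂ) (𝓝 ((l : ℂ)⁻¹))

variable {U : Set ℂ} {T S : ℂ → ℂ} {l r : ℝ}

theorem eventually_cobounded_mem {c : ℂ} (hUc : Uᶜ ⊆ Metric.closedBall c r) :
    ∀ᶠ z in Bornology.cobounded ℂ, z ∈ U := by
  filter_upwards [Bornology.isBounded_def.1
    (Metric.isBounded_closedBall (x := c) (r := r))] with z hz
  by_contra h
  exact hz (hUc h)

theorem tendsto_cobounded_of_div_tendsto {f : ℂ → ℂ} {a : ℂ} (ha : a ≠ 0)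
    (h : Tendsto (fun z => f z / z) (Bornology.cobounded ℂ) (𝓝 a)) :
    Tendsto f (Bornology.cobounded ℂ) (Bornology.cobounded ℂ) := by
  rw [← tendsto_norm_atTop_iff_cobounded]
  have h2 : Tendsto (fun z : ℂ => ‖f z / z‖ * ‖z‖) (Bornology.cobounded ℂ) atTop :=
    h.norm.pos_mul_atTop (norm_pos_iff.2 ha) tendsto_norm_cobounded_atTop
  refine h2.congr' ?_
  filter_upwards [Bornology.eventually_ne_cobounded (0 : ℂ)] with z hz
  rw [← norm_mul, div_mul_cancel₀ _ hz]

/-- In the coordinate `v = 1/z`, the map `P v = 1 / T (1/v)` has a removable singularity at `0` and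
is not locally constant there. By the open mapping theorem every large `ζ` is `T z` for some large
`z`, and then `S ζ = z`. -/
theorem tendsto_inverse_cobounded (hU : IsOpen U) {c : ℂ} (hUc : Uᶜ ⊆ Metric.closedBall c r)
    (hd : DifferentiableOn ℂ T U) (hl : 0 < l)
    (hT : Tendsto (fun z => T z / z) (Bornology.cobounded ℂ) (𝓝 (l : ℂ)))
    (hS : ∀ z ∈ U, S (T z) = z) :
    Tendsto S (Bornology.cobounded ℂ) (Bornology.cobounded ℂ) := by
  have hTinf := tendsto_cobounded_of_div_tendsto (Complex.ofReal_ne_zero.2 hl.ne') hT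
  have hinv : Tendsto (fun v : ℂ => v⁻¹) (𝓝[≠] 0) (Bornology.cobounded ℂ) :=
    tendsto_inv₀_nhdsNE_zero
  set P : ℂ → ℂ := Function.update (fun v => (T v⁻¹)⁻¹) 0 0 with hP
  have hP0 : P 0 = 0 := by simp [hP]
  have hPne : ∀ v, v ≠ 0 → P v = (T v⁻¹)⁻¹ := fun v hv => by simp [hP, hv]
  have hUv : ∀ᶠ v in 𝓝[≠] (0 : ℂ), v⁻¹ ∈ U := hinv.eventually (eventually_cobounded_mem hUc)
  have hTv : ∀ᶠ v in 𝓝[≠] (0 : ℂ), T v⁻¹ ≠ 0 :=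
    (hTinf.comp hinv).eventually (Bornology.eventually_ne_cobounded 0)
  have hA : AnalyticAt ℂ P 0 := by
    refine Complex.analyticAt_of_differentiable_on_punctured_nhds_of_continuousAt ?_ ?_
    · filter_upwards [hUv, hTv, self_mem_nhdsWithin] with v hv1 hv2 hv3
      have h1 : DifferentiableAt ℂ (fun v => (T v⁻¹)⁻¹) v :=
        ((hd.differentiableAt (hU.mem_nhds hv1)).comp v (differentiableAt_inv hv3)).inv hv2
      refine h1.congr_of_eventuallyEq ?_
      filter_upwards [isOpen_ne.mem_nhds hv3] with w hw using hPne w hw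
    · rw [hP, continuousAt_update_same]
      exact tendsto_inv₀_cobounded.comp (hTinf.comp hinv)
  have hopen : 𝓝 (0 : ℂ) ≤ map P (𝓝 0) := by
    have := hA.eventually_constant_or_nhds_le_map_nhds
    rw [hP0] at this
    refine this.resolve_left fun h => ?_
    obtain ⟨v, ⟨h1, h2⟩, h3⟩ :=
      (((h.filter_mono nhdsWithin_le_nhds).and hTv).and self_mem_nhdsWithin).exists
    rw [hPne v h3] at h1
    exact h2 (inv_eq_zero.1 h1)
  refine (hasBasis_cobounded_norm.tendsto_iff hasBasis_cobounded_norm).2 ?_ |>.mono_right le_rfl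
  intro R _
  have hbig : ∀ᶠ v in 𝓝[≠] (0 : ℂ), v⁻¹ ∈ U ∧ R ≤ ‖v⁻¹‖ := by
    refine hUv.and ?_
    exact (tendsto_norm_cobounded_atTop.comp hinv).eventually_ge_atTop R
  have hbig' := eventually_nhdsWithin_iff.1 hbig
  have himg := hopen (image_mem_map hbig')
  have hev := (tendsto_inv₀_cobounded (α := ℂ)).eventually himg
  obtain ⟨R', h1, h2⟩ := hasBasis_cobounded_norm.eventually_iff.1
    (hev.and (Bornology.eventually_ne_cobounded (0 : ℂ)))
  refine ⟨R', trivial, fun ζ hζ => ?_⟩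
  obtain ⟨⟨v, hv, hvζ⟩, hne⟩ := h2 hζ
  have hv0 : v ≠ 0 := by
    rintro rfl
    rw [hP0] at hvζ
    exact hne (inv_eq_zero.1 hvζ.symm)
  obtain ⟨hvU, hvR⟩ := hv hv0
  rw [hPne v hv0, inv_inj] at hvζ
  rw [mem_ofPred_eq, ← hvζ, hS _ hvU]
  exact hvR

theorem IsExteriorRiemannMap.exists_inverse (hT : IsExteriorRiemannMap U T) (hU : IsOpen U)
    {c : ℂ} (hUc : Uᶜ ⊆ Metric.closedBall c r) : ∃ S l, IsExteriorInverse U T S l := by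
  obtain ⟨l, hl, hlim⟩ := hT.infinity
  have hleft : ∀ z ∈ U, Function.invFunOn T U (T z) = z :=
    fun z hz => hT.bij.injOn.leftInvOn_invFunOn hz
  have hex : ∀ ζ : ℂ, 1 < ‖ζ‖ → ∃ z ∈ U, T z = ζ := fun ζ hζ => hT.bij.surjOn hζ
  have hmaps : ∀ ζ : ℂ, 1 < ‖ζ‖ → Function.invFunOn T U ζ ∈ U :=
    fun ζ hζ => Function.invFunOn_mem (hex ζ hζ)
  have hright : ∀ ζ : ℂ, 1 < ‖ζ‖ → T (Function.invFunOn T U ζ) = ζ :=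
    fun ζ hζ => Function.invFunOn_eq (hex ζ hζ)
  refine ⟨Function.invFunOn T U, l, hl, hleft, hmaps, hright, fun ζ hζ => ?_, hlim, ?_⟩
  · have := differentiableAt_leftInverse_of_injOn hU hT.holo hT.bij.injOn hleft (hmaps ζ hζ)
    rwa [hright ζ hζ] at this
  · have h1 := tendsto_inverse_cobounded hU hUc hT.holo hl hlim hleft
    have h2 := (hlim.comp h1).inv₀ (Complex.ofReal_ne_zero.2 hl.ne')
    refine h2.congr' ?_
    filter_upwards [tendsto_norm_cobounded_atTop.eventually_gt_atTop (1 : ℝ)] with ζ hζ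
    simp [hright ζ hζ]

theorem one_lt_norm_inv {w : ℂ} (hw : w ∈ Metric.ball (0 : ℂ) 1) (h0 : w ≠ 0) : 1 < ‖w⁻¹‖ := by
  rw [norm_inv]
  exact (one_lt_inv₀ (norm_pos_iff.2 h0)).2 (by simpa using hw)

noncomputable section

/-- The function `w ↦ w (S(1/w) - q)`, with its value at `0` filled in. -/
def diskInverse (S : ℂ → ℂ) (l : ℝ) (q : ℂ) : ℂ → ℂ :=
  Function.update (fun w => w * (S w⁻¹ - q)) 0 (l : ℂ)⁻¹

end

theorem diskInverse_zero (q : ℂ) : diskInverse S l q 0 = (l : ℂ)⁻¹ := by simp [diskInverse]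

theorem diskInverse_of_ne {w : ℂ} (q : ℂ) (hw : w ≠ 0) :
    diskInverse S l q w = w * (S w⁻¹ - q) := by simp [diskInverse, hw]

theorem IsExteriorInverse.diskInverse_differentiableOn (h : IsExteriorInverse U T S l) (q : ℂ) :
    DifferentiableOn ℂ (diskInverse S l q) (Metric.ball 0 1) := by
  rw [← Complex.differentiableOn_compl_singleton_and_continuousAt_iff
    (Metric.ball_mem_nhds (0 : ℂ) one_pos)]
  constructor
  · intro w hw
    have hw0 : w ≠ 0 := hw.2
    have h1 : DifferentiableAt ℂ (fun w => w * (S w⁻¹ - q)) w :=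
      differentiableAt_id.mul
        (((h.holo _ (one_lt_norm_inv hw.1 hw0)).comp w (differentiableAt_inv hw0)).sub_const q)
    refine (h1.congr_of_eventuallyEq ?_).differentiableWithinAt
    filter_upwards [isOpen_ne.mem_nhds hw0] with v hv using diskInverse_of_ne q hv
  · rw [diskInverse, continuousAt_update_same]
    have h1 : Tendsto (fun w : ℂ => S w⁻¹ / w⁻¹) (𝓝[≠] 0) (𝓝 ((l : ℂ)⁻¹)) :=
      h.tendsto_symm.comp tendsto_inv₀_nhdsNE_zero
    have h2 : Tendsto (fun w : ℂ => w * q) (𝓝[≠] 0) (𝓝 0) := by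
      have : Tendsto (fun w : ℂ => w * q) (𝓝 0) (𝓝 (0 * q)) := tendsto_id.mul_const q
      rw [zero_mul] at this
      exact this.mono_left nhdsWithin_le_nhds
    have h3 := h1.sub h2
    rw [sub_zero] at h3
    refine h3.congr fun w => ?_
    rw [div_inv_eq_mul]
    ring

/-- Off the origin, `S` would have to take the value `q`, but its values lie in `U`. Nonvanishing is
what makes the Harnack inequality applicable. -/
theorem IsExteriorInverse.diskInverse_ne_zero (h : IsExteriorInverse U T S l) {q w : ℂ}
    (hq : q ∉ U) (hw : w ∈ Metric.ball (0 : ℂ) 1) : diskInverse S l q w ≠ 0 := by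
  rcases eq_or_ne w 0 with rfl | h0
  · rw [diskInverse_zero]
    exact inv_ne_zero (Complex.ofReal_ne_zero.2 h.pos.ne')
  · rw [diskInverse_of_ne q h0]
    refine mul_ne_zero h0 (sub_ne_zero.2 fun heq => hq ?_)
    rw [← heq]
    exact h.maps _ (one_lt_norm_inv hw h0)

/-- An exterior Riemann map is bounded away from the unit circle outside a neighbourhood of the
obstacle. -/
theorem exists_one_lt_le_norm (hT : IsExteriorRiemannMap U T) {q : ℂ}
    (hUc : Uᶜ ⊆ Metric.closedBall q r) {R : ℝ} (hR : r < R) :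
    ∃ η, 1 < η ∧ ∀ z, R ≤ ‖z - q‖ → η ≤ ‖T z‖ := by
  obtain ⟨l, hl, hlim⟩ := hT.infinity
  have hinf := tendsto_cobounded_of_div_tendsto (Complex.ofReal_ne_zero.2 hl.ne') hlim
  have hmem : ∀ z, R ≤ ‖z - q‖ → z ∈ U := fun z hz => by
    by_contra h
    have := hUc h
    rw [mem_closedBall_iff_norm] at this
    linarith
  have hev : ∀ᶠ z in Bornology.cobounded ℂ, 2 ≤ ‖T z‖ :=
    (tendsto_norm_cobounded_atTop.comp hinf).eventually_ge_atTop 2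
  obtain ⟨ρ, _, hρ⟩ := hasBasis_cobounded_norm.eventually_iff.1 hev
  set K : Set ℂ := Metric.closedBall 0 ρ ∩ {z | R ≤ ‖z - q‖} with hK
  have hKc : IsCompact K := (isCompact_closedBall 0 ρ).inter_right
    (isClosed_le continuous_const (by fun_prop))
  have hcont : ContinuousOn (fun z => ‖T z‖) K :=
    (hT.holo.continuousOn.mono fun z hz => hmem z hz.2).norm
  have hout : ∀ z, z ∉ Metric.closedBall (0 : ℂ) ρ → 2 ≤ ‖T z‖ := fun z hz => by
    refine hρ ?_
    simp only [mem_closedBall_zero_iff, not_le] at hz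
    exact hz.le
  rcases K.eq_empty_or_nonempty with hE | hne
  · refine ⟨2, one_lt_two, fun z hz => hout z fun hzb => ?_⟩
    have : z ∈ K := ⟨hzb, hz⟩
    rw [hE] at this
    exact this
  · obtain ⟨z₀, hz₀, hmin⟩ := hKc.exists_isMinOn hne hcont
    refine ⟨min 2 ‖T z₀‖, lt_min one_lt_two (hT.bij.mapsTo (hmem _ hz₀.2)), fun z hz => ?_⟩
    by_cases hzb : z ∈ Metric.closedBall (0 : ℂ) ρ
    · exact (min_le_right _ _).trans (hmin ⟨hzb, hz⟩)
    · exact (min_le_left _ _).trans (hout z hzb)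

/-- Maximum principle on a circle of radius `ρ` close to `1`. Points at distance at least `r' > r`
from `q` have `η ≤ ‖T z‖` for some `η > 1`, so once `1/ρ < η` the points `S (1/v)`, `‖v‖ = ρ`, lie
within `r'` of `q`. Then `r'` decreases to `r`. -/
theorem IsExteriorInverse.norm_diskInverse_le (h : IsExteriorInverse U T S l)
    (hT : IsExteriorRiemannMap U T) {q : ℂ} (hUc : Uᶜ ⊆ Metric.closedBall q r)
    {w : ℂ} (hw : w ∈ Metric.ball (0 : ℂ) 1) : ‖diskInverse S l q w‖ ≤ r := by
  refine le_of_forall_gt_imp_ge_of_dense fun r' hr' => ?_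
  obtain ⟨η, hη, hfar⟩ := exists_one_lt_le_norm hT hUc hr'
  have hw1 : ‖w‖ < 1 := by simpa using hw
  obtain ⟨ρ, hρ1, hρ2⟩ := exists_between (max_lt hw1 (inv_lt_one_of_one_lt₀ hη))
  have hρ0 : 0 < ρ := (norm_nonneg w).trans_lt ((le_max_left _ _).trans_lt hρ1)
  have hsub : Metric.closedBall (0 : ℂ) ρ ⊆ Metric.ball 0 1 :=
    Metric.closedBall_subset_ball hρ2
  refine Complex.norm_le_of_forall_mem_frontier_norm_le (U := Metric.ball 0 ρ)
    Metric.isBounded_ball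
    (DifferentiableOn.diffContOnCl (𝕜 := ℂ) ?_) ?_ (subset_closure ?_)
  · rw [closure_ball _ hρ0.ne']
    exact (h.diskInverse_differentiableOn q).mono hsub
  · intro v hv
    rw [frontier_ball _ hρ0.ne', mem_sphere_zero_iff_norm] at hv
    have hv0 : v ≠ 0 := by
      rintro rfl
      rw [norm_zero] at hv
      exact hρ0.ne hv
    have hv1 : v ∈ Metric.ball (0 : ℂ) 1 := by rw [mem_ball_zero_iff, hv]; exact hρ2
    have hvS : ‖S v⁻¹ - q‖ < r' := by
      by_contra hcon
      have h1 := hfar _ (not_lt.1 hcon)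
      rw [h.right_inv _ (one_lt_norm_inv hv1 hv0), norm_inv, hv] at h1
      have h2 : η⁻¹ < ρ := (le_max_right _ _).trans_lt hρ1
      have h3 : ρ⁻¹ < η := by
        rw [inv_lt_comm₀ hρ0 (one_pos.trans hη)]
        exact h2
      linarith
    rw [diskInverse_of_ne q hv0, norm_mul, hv]
    nlinarith [norm_nonneg (S v⁻¹ - q)]
  · rw [mem_ball_zero_iff]
    exact (le_max_left _ _).trans_lt hρ1

/-- The Schwarz lemma at infinity. -/
theorem IsExteriorRiemannMap.norm_sub_le (hT : IsExteriorRiemannMap U T) (hU : IsOpen U) {q : ℂ}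
    (hUc : Uᶜ ⊆ Metric.closedBall q r) {z : ℂ} (hz : z ∈ U) :
    ‖z - q‖ ≤ r * ‖T z‖ := by
  obtain ⟨S, l, h⟩ := hT.exists_inverse hU hUc
  have h1 : 1 < ‖T z‖ := hT.bij.mapsTo hz
  have h0 : T z ≠ 0 := norm_pos_iff.1 (one_pos.trans h1)
  have := h.norm_diskInverse_le hT hUc (w := (T z)⁻¹)
    (by rw [mem_ball_zero_iff, norm_inv]; exact inv_lt_one_of_one_lt₀ h1)
  rw [diskInverse_of_ne q (inv_ne_zero h0), inv_inv, h.left_inv z hz, norm_mul, norm_inv,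
    inv_mul_le_iff₀ (one_pos.trans h1)] at this
  linarith

/-- The complement of the domain of an exterior Riemann map is not a single point. -/
theorem IsExteriorRiemannMap.not_compl_subset_singleton (hT : IsExteriorRiemannMap U T)
    (hU : IsOpen U) {q : ℂ} (hUc : Uᶜ ⊆ {q}) : False := by
  have h1 : q + 1 ∈ U := by
    by_contra h
    have := hUc h
    simp at this
  -- A one-point obstacle lies in disks of arbitrarily small radius; this radius makes the Schwarz
  -- bound at `q + 1` read `1 ≤ 1/2`.
  have h2 : Uᶜ ⊆ Metric.closedBall q (2 * ‖T (q + 1)‖)⁻¹ := fun z hz => by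
    rw [hUc hz]
    exact Metric.mem_closedBall_self (by positivity)
  have h3 := hT.norm_sub_le hU h2 h1
  have h4 : 1 < ‖T (q + 1)‖ := hT.bij.mapsTo h1
  rw [add_sub_cancel_left, norm_one, inv_mul_eq_div, le_div_iff₀ (by linarith)] at h3
  linarith

theorem mem_of_compl_subset_closedBall {q z : ℂ} (hUc : Uᶜ ⊆ Metric.closedBall q r)
    (hz : r < ‖z - q‖) : z ∈ U := by
  by_contra h
  have := hUc h
  rw [mem_closedBall_iff_norm] at this
  linarith

theorem closedBall_subset_closedBall_two_mul {q : ℂ} (hUc : Uᶜ ⊆ Metric.closedBall 0 r)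
    (hq : q ∉ U) : Uᶜ ⊆ Metric.closedBall q (2 * r) := fun z hz => by
  have h1 := hUc hz
  have h2 := hUc hq
  rw [mem_closedBall_zero_iff] at h1 h2
  rw [mem_closedBall_iff_norm]
  linarith [norm_sub_le z q]

/-- The derivative at infinity of an exterior Riemann map is controlled by the diameter of the
obstacle. -/
theorem IsExteriorInverse.le_inv (h : IsExteriorInverse U T S l)
    (hT : IsExteriorRiemannMap U T) (hr : 0 < r) (hUc : Uᶜ ⊆ Metric.closedBall 0 r) {q₁ q₂ : ℂ}
    (h₁ : q₁ ∉ U) (h₂ : q₂ ∉ U) {d : ℝ} (hd : 0 < d) (hdq : d ≤ dist q₁ q₂) :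
    (d / 6) ^ 3 / (3 * r) ^ 2 ≤ l⁻¹ := by
  set w : ℂ := 1 / 3 with hw
  have hwn : ‖w‖ = 1 / 3 := by simp [hw]
  have hw0 : w ≠ 0 := by simp [hw]
  have hmem : w ∈ Metric.ball (0 : ℂ) 1 := by rw [mem_ball_zero_iff, hwn]; norm_num
  -- The value at `0` is `1/l` for every `q`, so the Harnack inequality from `w` to `0` bounds `1/l`
  -- below by a lower bound at `w`. With radius `2/3` and `κ = 1/2` the exponential is `(a / (3
  -- r))²`, whence the cube. The bound `3 r` leaves strict room above `2 r`.
  have key : ∀ q, q ∉ U → d / 6 ≤ ‖diskInverse S l q w‖ →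
      (d / 6) ^ 3 / (3 * r) ^ 2 ≤ l⁻¹ := by
    intro q hq hbig
    have hsub : Metric.ball w (2 / 3) ⊆ Metric.ball (0 : ℂ) 1 := by
      refine Metric.ball_subset_ball' ?_
      rw [dist_zero_right, hwn]
      norm_num
    have hb : ∀ v ∈ Metric.ball (0 : ℂ) 1, ‖diskInverse S l q v‖ ≤ 2 * r := fun v hv =>
      h.norm_diskInverse_le hT (closedBall_subset_closedBall_two_mul hUc hq) hv
    have := norm_mul_exp_le_of_ne_zero (f := diskInverse S l q) (c := w) (z := 0) (R := 2 / 3)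
      (B := 3 * r) (κ := 1 / 2) (by norm_num)
      ((h.diskInverse_differentiableOn q).mono hsub)
      (fun v hv => h.diskInverse_ne_zero hq (hsub hv))
      (fun v hv => (hb v (hsub hv)).trans (by linarith))
      ((hb w hmem).trans_lt (by linarith)) (by norm_num)
      (by rw [zero_sub, norm_neg, hwn]; norm_num)
    rw [diskInverse_zero, norm_inv, Complex.norm_real, Real.norm_of_nonneg h.pos.le] at this
    refine le_trans ?_ this
    set a := ‖diskInverse S l q w‖
    have ha : 0 < a := lt_of_lt_of_le (by positivity) hbig
    have hexp : Real.exp (-(2 * (1 / 2) / (1 - 1 / 2) * Real.log (3 * r / a)))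
        = (a / (3 * r)) ^ 2 := by
      rw [show -(2 * (1 / 2) / (1 - 1 / 2) * Real.log (3 * r / a))
        = (2 : ℕ) * Real.log (a / (3 * r)) by
          rw [← inv_div a, Real.log_inv]; push_cast; ring]
      rw [Real.exp_nat_mul, Real.exp_log (by positivity)]
    rw [hexp, div_pow a, ← mul_div_assoc, ← pow_succ']
    gcongr
  by_contra hcon
  have e1 : ‖diskInverse S l q₁ w‖ < d / 6 := not_le.1 fun hh => hcon (key q₁ h₁ hh)
  have e2 : ‖diskInverse S l q₂ w‖ < d / 6 := not_le.1 fun hh => hcon (key q₂ h₂ hh)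
  -- The two values differ by at least `d/3` in modulus, so they cannot both be smaller than `d/6`.
  have e3 : diskInverse S l q₂ w - diskInverse S l q₁ w = w * (q₁ - q₂) := by
    rw [diskInverse_of_ne _ hw0, diskInverse_of_ne _ hw0]
    ring
  have e4 := norm_sub_le (diskInverse S l q₂ w) (diskInverse S l q₁ w)
  rw [e3, norm_mul, hwn, ← dist_eq_norm] at e4
  linarith

/-- An exterior Riemann map grows at most linearly, with a constant that depends only on the size
of the obstacle. -/
theorem exists_forall_norm_le_mul_norm {r R d : ℝ} (hr : 0 < r) (hR : r < R) (hd : 0 < d) :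
    ∃ M, 0 < M ∧ ∀ (U : Set ℂ) (T : ℂ → ℂ), IsOpen U → Uᶜ ⊆ Metric.closedBall 0 r →
      IsExteriorRiemannMap U T → (∃ q₁ ∉ U, ∃ q₂ ∉ U, d ≤ dist q₁ q₂) →
      ∀ z, R ≤ ‖z‖ → ‖T z‖ ≤ M * ‖z‖ := by
  set μ := (d / 6) ^ 3 / (3 * r) ^ 2 with hμ
  have hμ0 : 0 < μ := by positivity
  set κ := r / R with hκ
  have hR0 : 0 < R := hr.trans hR
  have hκ0 : 0 < κ := by positivity
  have hκ1 : κ < 1 := (div_lt_one hR0).2 hR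
  set c := μ * Real.exp (-(2 * κ / (1 - κ) * Real.log (3 * r / μ))) with hc
  have hc0 : 0 < c := by positivity
  refine ⟨c⁻¹, by positivity, ?_⟩
  rintro U T hU hUc hT ⟨q₁, h₁, q₂, h₂, hq⟩ z hz
  obtain ⟨S, l, h⟩ := hT.exists_inverse hU hUc
  have hμl : μ ≤ l⁻¹ := h.le_inv hT hr hUc h₁ h₂ hd hq
  have hl := h.pos
  have hlr : l⁻¹ ≤ r := by
    have := h.norm_diskInverse_le hT hUc (Metric.mem_ball_self one_pos)
    rwa [diskInverse_zero, norm_inv, Complex.norm_real, Real.norm_of_nonneg hl.le] at this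
  -- `p v` is `z / T z` at `z = 1/v`, with value `1/l` at infinity. It is nonvanishing and bounded
  -- by the Schwarz lemma, so the Harnack inequality carries the lower bound on `1/l` to all `‖z‖ ≥
  -- R`.
  set p : ℂ → ℂ := Function.update (fun v => (v * T v⁻¹)⁻¹) 0 (l : ℂ)⁻¹ with hp
  have hp0 : ‖p 0‖ = l⁻¹ := by
    simp [hp, abs_of_pos hl]
  have hpne : ∀ v, v ≠ 0 → p v = (v * T v⁻¹)⁻¹ := fun v hv => by simp [hp, hv]
  have hmem : ∀ v ∈ Metric.ball (0 : ℂ) r⁻¹, v ≠ 0 → v⁻¹ ∈ U := fun v hv hv0 => by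
    refine mem_of_compl_subset_closedBall hUc ?_
    rw [sub_zero, norm_inv, lt_inv_comm₀ hr (norm_pos_iff.2 hv0)]
    simpa using hv
  have hTne : ∀ u ∈ U, T u ≠ 0 := fun u hu =>
    norm_pos_iff.1 (one_pos.trans (hT.bij.mapsTo hu))
  have hdiff : DifferentiableOn ℂ p (Metric.ball 0 r⁻¹) := by
    rw [← Complex.differentiableOn_compl_singleton_and_continuousAt_iff
      (Metric.ball_mem_nhds (0 : ℂ) (inv_pos.2 hr))]
    constructor
    · intro v hv
      have hv0 : v ≠ 0 := hv.2
      have hvU := hmem v hv.1 hv0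
      have h1 : DifferentiableAt ℂ (fun v => (v * T v⁻¹)⁻¹) v :=
        (differentiableAt_id.mul ((hT.holo.differentiableAt (hU.mem_nhds hvU)).comp v
          (differentiableAt_inv hv0))).inv (mul_ne_zero hv0 (hTne _ hvU))
      refine (h1.congr_of_eventuallyEq ?_).differentiableWithinAt
      filter_upwards [isOpen_ne.mem_nhds hv0] with w hw using hpne w hw
    · rw [hp, continuousAt_update_same]
      have h1 : Tendsto (fun w : ℂ => T w⁻¹ / w⁻¹) (𝓝[≠] 0) (𝓝 (l : ℂ)) :=
        h.tendsto.comp tendsto_inv₀_nhdsNE_zero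
      refine (h1.inv₀ (Complex.ofReal_ne_zero.2 hl.ne')).congr fun w => ?_
      rw [div_inv_eq_mul, mul_comm]
  have hpnz : ∀ v ∈ Metric.ball (0 : ℂ) r⁻¹, p v ≠ 0 := by
    intro v hv
    rcases eq_or_ne v 0 with rfl | hv0
    · rw [← norm_pos_iff, hp0]
      positivity
    · rw [hpne v hv0]
      exact inv_ne_zero (mul_ne_zero hv0 (hTne _ (hmem v hv hv0)))
  have hple : ∀ v ∈ Metric.ball (0 : ℂ) r⁻¹, ‖p v‖ ≤ 3 * r := by
    intro v hv
    rcases eq_or_ne v 0 with rfl | hv0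
    · rw [hp0]
      linarith
    · have h1 := hT.norm_sub_le hU hUc (hmem v hv hv0)
      have h2 : 0 < ‖T v⁻¹‖ := norm_pos_iff.2 (hTne _ (hmem v hv hv0))
      rw [hpne v hv0, mul_inv, norm_mul, norm_inv (T _), ← div_eq_mul_inv, div_le_iff₀ h2]
      rw [sub_zero] at h1
      nlinarith
  have hz0 : 0 < ‖z‖ := hR0.trans_le hz
  have hzne : z ≠ 0 := norm_pos_iff.1 hz0
  have hzU : z ∈ U := mem_of_compl_subset_closedBall hUc (by rw [sub_zero]; linarith)
  have hT0 : 0 < ‖T z‖ := norm_pos_iff.2 (hTne z hzU)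
  have main := norm_mul_exp_le_of_ne_zero (f := p) (c := 0) (z := z⁻¹) (B := 3 * r) (κ := κ)
    (inv_pos.2 hr) hdiff hpnz hple (by rw [hp0]; linarith) hκ1
    (by rw [sub_zero, norm_inv, hκ, div_mul_eq_mul_div, mul_inv_cancel₀ hr.ne', one_div]
        exact inv_anti₀ hR0 hz)
  rw [hp0, hpne _ (inv_ne_zero hzne), inv_inv, mul_inv, inv_inv, norm_mul, norm_inv] at main
  have hcle : c ≤ ‖z‖ * ‖T z‖⁻¹ := by
    refine le_trans ?_ main
    have : 0 < l⁻¹ := inv_pos.2 hl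
    have : 0 < 1 - κ := by linarith
    rw [hc]
    gcongr
  rw [← div_eq_mul_inv, le_div_iff₀ hT0] at hcle
  rw [inv_mul_eq_div, le_div_iff₀ hc0]
  linarith

/-- Cauchy's estimate on a circle about `x` of radius proportional to `‖x‖`: linear growth of `T`
cancels against the radius. The choice `θ = 1 - R'/R` keeps the circle in `R' ≤ ‖y‖`. -/
theorem exists_forall_norm_deriv_le {r R d : ℝ} (hr : 0 < r) (hR : r < R) (hd : 0 < d) :
    ∃ A, 0 < A ∧ ∀ (U : Set ℂ) (T : ℂ → ℂ), IsOpen U → Uᶜ ⊆ Metric.closedBall 0 r →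
      IsExteriorRiemannMap U T → (∃ q₁ ∉ U, ∃ q₂ ∉ U, d ≤ dist q₁ q₂) →
      ∀ x, R ≤ ‖x‖ → ‖deriv T x‖ ≤ A := by
  obtain ⟨R', hr', hR'⟩ := exists_between hR
  obtain ⟨M, hM, hbound⟩ := exists_forall_norm_le_mul_norm hr hr' hd
  have hR0 : 0 < R := hr.trans hR
  set θ := 1 - R' / R with hθ
  have hR'0 : 0 < R' := hr.trans hr'
  have hθ0 : 0 < θ := sub_pos.2 ((div_lt_one hR0).2 hR')
  have hθ1 : θ ≤ 1 := by rw [hθ]; linarith [div_pos hR'0 hR0]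
  refine ⟨2 * M / θ, by positivity, fun U T hU hUc hT hq x hx => ?_⟩
  have hx0 : 0 < ‖x‖ := hR0.trans_le hx
  have hfar : ∀ y ∈ Metric.closedBall x (θ * ‖x‖), R' ≤ ‖y‖ := by
    intro y hy
    rw [mem_closedBall_iff_norm'] at hy
    have h1 : ‖x‖ - ‖y‖ ≤ θ * ‖x‖ := (norm_sub_norm_le x y).trans hy
    have h2 : R' / R * R ≤ R' / R * ‖x‖ := by gcongr
    rw [div_mul_cancel₀ _ hR0.ne'] at h2
    rw [hθ] at h1
    linarith
  have := Complex.norm_deriv_le_of_forall_mem_sphere_norm_le (f := T) (c := x) (R := θ * ‖x‖)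
    (C := 2 * M * ‖x‖) (by positivity) ?_ ?_
  · refine this.trans (le_of_eq ?_)
    field_simp
  · refine DifferentiableOn.diffContOnCl ?_
    refine hT.holo.mono fun y hy => ?_
    refine mem_of_compl_subset_closedBall hUc ?_
    have := hfar y (Metric.closure_ball_subset_closedBall hy)
    rw [sub_zero]
    linarith
  · intro y hy
    refine (hbound U T hU hUc hT hq y (hfar y (Metric.sphere_subset_closedBall hy))).trans ?_
    rw [mem_sphere_iff_norm] at hy
    have h1 : ‖y‖ ≤ ‖y - x‖ + ‖x‖ := norm_le_norm_sub_add y x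
    have h2 : θ * ‖x‖ ≤ ‖x‖ := mul_le_of_le_one_left hx0.le hθ1
    nlinarith

/-- Away from the unit circle, the inverse of an exterior Riemann map is Lipschitz. -/
theorem IsExteriorInverse.norm_sub_le (h : IsExteriorInverse U T S l)
    (hT : IsExteriorRiemannMap U T) (hr : 0 < r) (hUc : Uᶜ ⊆ Metric.closedBall 0 r) {ρ : ℝ}
    (hρ0 : 0 < ρ) (hρ : ρ < 1) {ζ η : ℂ} (hζ : ρ⁻¹ ≤ ‖ζ‖) (hη : ρ⁻¹ ≤ ‖η‖) :
    ‖S ζ - S η‖ ≤ (r + 2 * r / (1 - ρ)) * ‖ζ - η‖ := by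
  set m := diskInverse S l 0 with hm
  have hmb : ∀ w ∈ Metric.ball (0 : ℂ) 1, ‖m w‖ ≤ r := fun w hw =>
    h.norm_diskInverse_le hT hUc hw
  have hmd : DifferentiableOn ℂ m (Metric.ball 0 1) := h.diskInverse_differentiableOn 0
  have h1ρ : 0 < 1 - ρ := by linarith
  have hderiv : ∀ w ∈ Metric.closedBall (0 : ℂ) ρ, ‖deriv m w‖ ≤ 2 * r / (1 - ρ) := by
    intro w hw
    have hsub : Metric.closedBall w ((1 - ρ) / 2) ⊆ Metric.ball 0 1 := by
      refine Metric.closedBall_subset_ball' ?_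
      rw [Metric.mem_closedBall] at hw
      linarith
    have := Complex.norm_deriv_le_of_forall_mem_sphere_norm_le (f := m) (c := w)
      (R := (1 - ρ) / 2) (C := r) (by linarith)
      (DifferentiableOn.diffContOnCl (hmd.mono (Metric.closure_ball_subset_closedBall.trans hsub)))
      (fun v hv => hmb v (hsub (Metric.sphere_subset_closedBall hv)))
    refine this.trans (le_of_eq ?_)
    field_simp
  have hin : ∀ ζ : ℂ, ρ⁻¹ ≤ ‖ζ‖ → ζ⁻¹ ∈ Metric.closedBall (0 : ℂ) ρ := fun ζ hζ => by
    rw [mem_closedBall_zero_iff, norm_inv]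
    exact inv_le_of_inv_le₀ hρ0 hζ
  have hne : ∀ ζ : ℂ, ρ⁻¹ ≤ ‖ζ‖ → ζ ≠ 0 := fun ζ hζ =>
    norm_pos_iff.1 ((inv_pos.2 hρ0).trans_le hζ)
  have hball : Metric.closedBall (0 : ℂ) ρ ⊆ Metric.ball 0 1 := Metric.closedBall_subset_ball hρ
  have hSm : ∀ ζ : ℂ, ρ⁻¹ ≤ ‖ζ‖ → S ζ = ζ * m ζ⁻¹ := fun ζ hζ => by
    rw [hm, diskInverse_of_ne _ (inv_ne_zero (hne ζ hζ)), inv_inv, sub_zero,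
      mul_inv_cancel_left₀ (hne ζ hζ)]
  have hlip : ‖m ζ⁻¹ - m η⁻¹‖ ≤ 2 * r / (1 - ρ) * ‖ζ⁻¹ - η⁻¹‖ :=
    (convex_closedBall (0 : ℂ) ρ).norm_image_sub_le_of_norm_deriv_le
      (fun w hw => hmd.differentiableAt (Metric.isOpen_ball.mem_nhds (hball hw))) hderiv
      (hin η hη) (hin ζ hζ)
  have hζ0 := hne ζ hζ
  have hη0 := hne η hη
  have hinv : ‖ζ⁻¹ - η⁻¹‖ = ‖ζ - η‖ * (‖ζ‖⁻¹ * ‖η‖⁻¹) := by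
    rw [inv_sub_inv hζ0 hη0, norm_div, norm_mul, norm_sub_rev, div_eq_mul_inv, mul_inv]
  have hζ1 : ‖ζ‖⁻¹ ≤ 1 := by
    have := hball (hin ζ hζ)
    rw [mem_ball_zero_iff, norm_inv] at this
    exact this.le
  -- With `S ζ = ζ m(1/ζ)`, the factor `‖η‖` in the second term is absorbed by `‖1/ζ - 1/η‖ = ‖ζ -
  -- η‖ / (‖ζ‖ ‖η‖)`.
  rw [hSm ζ hζ, hSm η hη,
    show ζ * m ζ⁻¹ - η * m η⁻¹ = (ζ - η) * m ζ⁻¹ + η * (m ζ⁻¹ - m η⁻¹) by ring]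
  refine (norm_add_le _ _).trans ?_
  rw [norm_mul, norm_mul, add_mul]
  refine add_le_add ?_ ?_
  · rw [mul_comm]
    gcongr
    exact hmb _ (hball (hin ζ hζ))
  · calc ‖η‖ * ‖m ζ⁻¹ - m η⁻¹‖ ≤ ‖η‖ * (2 * r / (1 - ρ) * (‖ζ - η‖ * (‖ζ‖⁻¹ * ‖η‖⁻¹))) := by
          rw [← hinv]
          gcongr
      _ = 2 * r / (1 - ρ) * ‖ζ - η‖ * ‖ζ‖⁻¹ * (‖η‖ * ‖η‖⁻¹) := by ring
      _ = 2 * r / (1 - ρ) * ‖ζ - η‖ * ‖ζ‖⁻¹ := by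
          rw [mul_inv_cancel₀ (norm_ne_zero_iff.2 hη0), mul_one]
      _ ≤ 2 * r / (1 - ρ) * ‖ζ - η‖ * 1 := by gcongr
      _ = _ := mul_one _

/-! ### Pointwise bound for the Biot–Savart kernel. -/

theorem norm_inv_sq_smul (z : ℂ) : ‖(‖z‖ ^ 2)⁻¹ • z‖ = ‖z‖⁻¹ := by
  rcases eq_or_ne z 0 with rfl | hz
  · simp
  · have := norm_ne_zero_iff.2 hz
    rw [norm_smul, norm_inv, norm_pow, norm_norm]
    field_simp

theorem norm_perp (z : ℂ) : ‖perp z‖ = ‖z‖ := by simp [perp]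

/-- The Biot-Savart kernel is bounded by `|x - y|⁻¹ + 1`, with a constant that depends only on the
size of the obstacle and on the distance of `x` from it. -/
theorem exists_forall_norm_biotSavartIntegrand_le {r R : ℝ} (hr : 0 < r) (hR : r < R) :
    ∃ M, 0 < M ∧ ∀ (U : Set ℂ) (T : ℂ → ℂ), IsOpen U → Uᶜ ⊆ Metric.closedBall 0 r →
      IsExteriorRiemannMap U T → ∀ (w : ℂ → ℝ) (x y : ℂ), R ≤ ‖x‖ → y ∈ U →
      ‖biotSavartIntegrand T w x y‖ ≤ M * (‖w y‖ * (‖x - y‖⁻¹ + 1)) := by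
  have hR0 : 0 < R := hr.trans hR
  -- Chosen so that the Schwarz lemma gives `1 + 2δ ≤ ‖T x‖`. The reflected point `(T y)^*` lies in
  -- the unit disk, hence at distance at least `δ` from `T x`.
  set δ := (R / r - 1) / 2 with hδ
  have hδ0 : 0 < δ := by
    have := (one_lt_div hr).2 hR
    rw [hδ]
    linarith
  set ρ := (1 + δ)⁻¹ with hρ
  have hρ0 : 0 < ρ := by positivity
  have hρ1 : ρ < 1 := inv_lt_one_of_one_lt₀ (by linarith)
  set L := r + 2 * r / (1 - ρ) with hL
  have h1ρ : 0 < 1 - ρ := by linarith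
  have hL0 : 0 < L := by positivity
  refine ⟨L + 2 * δ⁻¹, by positivity, fun U T hU hUc hT w x y hx hy => ?_⟩
  obtain ⟨S, l, h⟩ := hT.exists_inverse hU hUc
  have hxU : x ∈ U := mem_of_compl_subset_closedBall hUc (by rw [sub_zero]; linarith)
  have hTx : 1 + 2 * δ ≤ ‖T x‖ := by
    have := hT.norm_sub_le hU hUc hxU
    rw [sub_zero] at this
    rw [hδ, mul_div_cancel₀ _ two_ne_zero, add_sub_cancel, div_le_iff₀ hr]
    linarith
  have hTy : 1 < ‖T y‖ := hT.bij.mapsTo hy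
  have hsecond : ‖T x - circleInv (T y)‖⁻¹ ≤ δ⁻¹ := by
    refine inv_anti₀ hδ0 ?_
    have h1 : ‖circleInv (T y)‖ ≤ 1 := by
      rw [circleInv, norm_inv_sq_smul]
      exact (inv_lt_one_of_one_lt₀ hTy).le
    have := norm_sub_norm_le (T x) (circleInv (T y))
    linarith
  have hfirst : ‖T x - T y‖⁻¹ ≤ L * ‖x - y‖⁻¹ + δ⁻¹ := by
    -- Either `T y` is near the unit circle, and then far from `T x`, or both images lie where `S`
    -- is Lipschitz with constant `L`, so that `‖x - y‖ ≤ L ‖T x - T y‖`.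
    rcases le_total ‖T y‖ (1 + δ) with hc | hc
    · have : ‖T x - T y‖⁻¹ ≤ δ⁻¹ := by
        refine inv_anti₀ hδ0 ?_
        have := norm_sub_norm_le (T x) (T y)
        linarith
      have : 0 ≤ L * ‖x - y‖⁻¹ := by positivity
      linarith
    · have hlip := h.norm_sub_le hT hr hUc hρ0 hρ1 (ζ := T x) (η := T y)
        (by rw [hρ, inv_inv]; linarith) (by rw [hρ, inv_inv]; linarith)
      rw [h.left_inv x hxU, h.left_inv y hy, ← hL] at hlip
      have : ‖T x - T y‖⁻¹ ≤ L * ‖x - y‖⁻¹ := by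
        rcases eq_or_ne x y with rfl | hxy
        · simp
        · have hpos : 0 < ‖x - y‖ := norm_pos_iff.2 (sub_ne_zero.2 hxy)
          have hpos' : 0 < ‖T x - T y‖ := by
            by_contra hcon
            have : ‖T x - T y‖ = 0 := le_antisymm (not_lt.1 hcon) (norm_nonneg _)
            rw [this, mul_zero] at hlip
            linarith
          rw [← div_eq_mul_inv, le_div_iff₀ hpos, inv_mul_le_iff₀ hpos']
          linarith
      have : 0 ≤ δ⁻¹ := by positivity
      linarith
  rw [biotSavartIntegrand, norm_smul, norm_perp, mul_left_comm]
  refine mul_le_mul_of_nonneg_left ?_ (norm_nonneg _)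
  refine (_root_.norm_sub_le _ _).trans ?_
  rw [norm_inv_sq_smul, norm_inv_sq_smul]
  have : 0 ≤ 2 * δ⁻¹ * ‖x - y‖⁻¹ := by positivity
  nlinarith

/-! ### Transport of the vorticity -/

noncomputable section

/-- The spatial curl of a velocity field on space-time. -/
def spaceCurl (F : ℝ × ℂ → ℂ) (z : ℝ × ℂ) : ℝ :=
  (fderiv ℝ F z (0, 1)).im - (fderiv ℝ F z (0, Complex.I)).re

theorem contDiff_spaceCurl {F : ℝ × ℂ → ℂ} (hF : ContDiff ℝ ∞ F) :
    ContDiff ℝ ∞ (spaceCurl F) := by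
  have hD : ContDiff ℝ ∞ (fderiv ℝ F) := hF.fderiv_right (m := ∞) (by simp)
  have h1 := Complex.imCLM.contDiff.comp (hD.clm_apply (contDiff_const (c := ((0 : ℝ), (1 : ℂ)))))
  have h2 := Complex.reCLM.contDiff.comp
    (hD.clm_apply (contDiff_const (c := ((0 : ℝ), Complex.I))))
  exact h1.sub h2

theorem fderiv_apply_snd (L : ℝ × ℂ →L[ℝ] ℂ) (a : ℂ) :
    L (0, a) = a.re • L (0, 1) + a.im • L (0, Complex.I) := by
  rw [← map_smul, ← map_smul, ← map_add]
  congr 1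
  ext <;> simp

theorem two_le_infty : (2 : WithTop ℕ∞) ≤ ((⊤ : ℕ∞) : WithTop ℕ∞) := by
  exact WithTop.coe_le_coe.2 (le_top : (2 : ℕ∞) ≤ ⊤)

/-- The vorticity of a smooth Euler flow is transported by the flow. -/
theorem fderiv_spaceCurl_eq_zero {F : ℝ × ℂ → ℂ} {Q : ℝ × ℂ → ℝ} (hF : ContDiff ℝ ∞ F)
    (hQ : ContDiff ℝ ∞ Q) {V : Set (ℝ × ℂ)} (hV : IsOpen V)
    (hre : ∀ z ∈ V, (fderiv ℝ F z (1, F z)).re + fderiv ℝ Q z (0, 1) = 0)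
    (him : ∀ z ∈ V, (fderiv ℝ F z (1, F z)).im + fderiv ℝ Q z (0, Complex.I) = 0)
    (hdiv : ∀ z ∈ V, (fderiv ℝ F z (0, 1)).re + (fderiv ℝ F z (0, Complex.I)).im = 0)
    {z : ℝ × ℂ} (hz : z ∈ V) : fderiv ℝ (spaceCurl F) z (1, F z) = 0 := by
  have hD : ContDiff ℝ ∞ (fderiv ℝ F) := hF.fderiv_right (m := ∞) (by simp)
  have hDQ : ContDiff ℝ ∞ (fderiv ℝ Q) := hQ.fderiv_right (m := ∞) (by simp)
  have dF : HasFDerivAt F (fderiv ℝ F z) z := (hF.differentiable (by simp) z).hasFDerivAt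
  have dD : HasFDerivAt (fderiv ℝ F) (fderiv ℝ (fderiv ℝ F) z) z :=
    (hD.differentiable (by simp) z).hasFDerivAt
  have dDQ : HasFDerivAt (fderiv ℝ Q) (fderiv ℝ (fderiv ℝ Q) z) z :=
    (hDQ.differentiable (by simp) z).hasFDerivAt
  have symF : IsSymmSndFDerivAt ℝ F z :=
    hF.contDiffAt.isSymmSndFDerivAt (by simpa using two_le_infty)
  have symQ : IsSymmSndFDerivAt ℝ Q z :=
    hQ.contDiffAt.isSymmSndFDerivAt (by simpa using two_le_infty)
  have dN := dD.clm_apply ((hasFDerivAt_const (1 : ℝ) z).prodMk dF)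
  have dQ1 := dDQ.clm_apply (hasFDerivAt_const ((0 : ℝ), (1 : ℂ)) z)
  have dQ2 := dDQ.clm_apply (hasFDerivAt_const ((0 : ℝ), Complex.I) z)
  have d1 := (Complex.reCLM.hasFDerivAt.comp z dN).add dQ1
  have d2 := (Complex.imCLM.hasFDerivAt.comp z dN).add dQ2
  have z1 := d1.unique ((hasFDerivAt_const (0 : ℝ) z).congr_of_eventuallyEq
    (by filter_upwards [hV.mem_nhds hz] with y hy using hre y hy))
  have z2 := d2.unique ((hasFDerivAt_const (0 : ℝ) z).congr_of_eventuallyEq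
    (by filter_upwards [hV.mem_nhds hz] with y hy using him y hy))
  -- Curl of the momentum equation: `∂₂` of the first component and `∂₁` of the second. In the
  -- difference the pressure cancels by symmetry of second derivatives, and what remains besides
  -- transport is curl times divergence.
  have e1 := DFunLike.congr_fun z1 ((0 : ℝ), Complex.I)
  have e2 := DFunLike.congr_fun z2 ((0 : ℝ), (1 : ℂ))
  have c1 := Complex.imCLM.hasFDerivAt.comp z
    (dD.clm_apply (hasFDerivAt_const ((0 : ℝ), (1 : ℂ)) z))
  have c2 := Complex.reCLM.hasFDerivAt.comp z
    (dD.clm_apply (hasFDerivAt_const ((0 : ℝ), Complex.I) z))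
  have hW : HasFDerivAt (spaceCurl F) _ z := c1.sub c2
  rw [hW.fderiv]
  simp only [add_apply, ContinuousLinearMap.comp_apply,
    ContinuousLinearMap.flip_apply, ContinuousLinearMap.prod_apply,
    zero_apply, map_zero, zero_add, Complex.reCLM_apply,
    Complex.imCLM_apply, sub_apply, Complex.add_re, Complex.add_im] at e1 e2 ⊢
  have hd := hdiv z hz
  rw [symF.eq (1, F z) (0, 1), symF.eq (1, F z) (0, Complex.I)]
  rw [symQ.eq (0, Complex.I) (0, 1)] at e1
  rw [fderiv_apply_snd _ (fderiv ℝ F z (0, Complex.I))] at e1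
  rw [fderiv_apply_snd _ (fderiv ℝ F z (0, 1))] at e2
  simp only [Complex.add_re, Complex.add_im, Complex.real_smul, Complex.re_ofReal_mul,
    Complex.im_ofReal_mul] at e1 e2
  linear_combination e2 - e1 - ((fderiv ℝ F z (0, 1)).im - (fderiv ℝ F z (0, Complex.I)).re) * hd

/-- A cutoff travelling inwards at speed `M`: it equals `1` where `√(1 + |x|²) + M t ≤ R` and
vanishes where `√(1 + |x|²) + M t ≥ R + 1`. -/
def travellingCutoff (M R : ℝ) (z : ℝ × ℂ) : ℝ :=
  1 - Real.smoothTransition (√(1 + ‖z.2‖ ^ 2) + M * z.1 - R)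

/-- This is a smooth substitute for `‖x‖`, still with gradient of norm at most `1`. -/
theorem contDiff_sqrt_one_add : ContDiff ℝ ∞ fun x : ℂ => √(1 + ‖x‖ ^ 2) :=
  (contDiff_const.add (contDiff_norm_sq ℝ)).sqrt fun x => by positivity

theorem contDiff_travellingCutoff (M R : ℝ) : ContDiff ℝ ∞ (travellingCutoff M R) := by
  refine contDiff_const.sub (Real.smoothTransition.contDiff.comp ?_)
  exact ((contDiff_sqrt_one_add.comp contDiff_snd).add (contDiff_const.mul contDiff_fst)).sub
    contDiff_const

theorem travellingCutoff_nonneg (M R : ℝ) (z : ℝ × ℂ) : 0 ≤ travellingCutoff M R z :=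
  sub_nonneg.2 (Real.smoothTransition.le_one _)

theorem travellingCutoff_le_one (M R : ℝ) (z : ℝ × ℂ) : travellingCutoff M R z ≤ 1 :=
  sub_le_self _ (Real.smoothTransition.nonneg _)

theorem travellingCutoff_eq_zero {M R : ℝ} {z : ℝ × ℂ} (h : R + 1 - M * z.1 ≤ ‖z.2‖) :
    travellingCutoff M R z = 0 := by
  have : ‖z.2‖ ≤ √(1 + ‖z.2‖ ^ 2) := Real.le_sqrt_of_sq_le (by linarith)
  rw [travellingCutoff, Real.smoothTransition.one_of_one_le (by linarith), sub_self]

theorem travellingCutoff_eq_one {M R : ℝ} {z : ℝ × ℂ} (h : √(1 + ‖z.2‖ ^ 2) + M * z.1 ≤ R) :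
    travellingCutoff M R z = 1 := by
  rw [travellingCutoff, Real.smoothTransition.zero_of_nonpos (by linarith), sub_zero]

/-- The front moves inwards at speed `M`, so no particle of speed at most `M` can cross it inwards:
along its path `√(1 + |x|²) + M t` does not decrease. -/
theorem fderiv_travellingCutoff_nonpos {M R : ℝ} (z : ℝ × ℂ) {v : ℂ} (hv : ‖v‖ ≤ M) :
    fderiv ℝ (travellingCutoff M R) z (1, v) ≤ 0 := by
  have hpos : (1 + ‖z.2‖ ^ 2 : ℝ) ≠ 0 := by positivity
  have h1 : HasFDerivAt (fun x : ℂ => √(1 + ‖x‖ ^ 2)) _ z.2 :=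
    ((hasStrictFDerivAt_norm_sq z.2).hasFDerivAt.const_add (1 : ℝ)).sqrt hpos
  have h2 := ((h1.comp z (hasFDerivAt_snd (𝕜 := ℝ) (E := ℝ) (F := ℂ) (p := z))).add
    ((hasFDerivAt_fst (𝕜 := ℝ) (E := ℝ) (F := ℂ) (p := z)).const_mul M)).sub_const R
  have h3 : HasDerivAt Real.smoothTransition _ (√(1 + ‖z.2‖ ^ 2) + M * z.1 - R) :=
    ((Real.smoothTransition.contDiff (n := 1)).differentiable (by simp) _).hasDerivAt
  have h4 : HasFDerivAt (travellingCutoff M R) _ z := 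
    (HasDerivAt.comp_hasFDerivAt (h₂ := Real.smoothTransition) z h3 h2).const_sub 1
  rw [h4.fderiv]
  have h5 : 0 ≤ deriv Real.smoothTransition (√(1 + ‖z.2‖ ^ 2) + M * z.1 - R) :=
    Real.smoothTransition.monotone.deriv_nonneg
  have h6 : |inner ℝ z.2 v| ≤ ‖z.2‖ * ‖v‖ := abs_real_inner_le_norm _ _
  have h7 : ‖z.2‖ ≤ √(1 + ‖z.2‖ ^ 2) := Real.le_sqrt_of_sq_le (by linarith)
  have h8 : 0 < √(1 + ‖z.2‖ ^ 2) := Real.sqrt_pos.2 (by positivity)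
  have h9 : -M ≤ (√(1 + ‖z.2‖ ^ 2))⁻¹ * inner ℝ z.2 v := by
    rw [inv_mul_eq_div, le_div_iff₀ h8]
    have : ‖z.2‖ * ‖v‖ ≤ √(1 + ‖z.2‖ ^ 2) * M := by gcongr
    linarith [(abs_le.1 h6).1]
  have h10 : (1 / (2 * √(1 + ‖z.2‖ ^ 2))) * (2 * inner ℝ z.2 v)
      = (√(1 + ‖z.2‖ ^ 2))⁻¹ * inner ℝ z.2 v := by
    field_simp
  simp only [neg_apply, smul_apply,
    add_apply, ContinuousLinearMap.comp_apply, ContinuousLinearMap.coe_fst',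
    ContinuousLinearMap.coe_snd', innerSL_apply_apply, smul_eq_mul, nsmul_eq_mul, mul_one,
    Nat.cast_ofNat]
  rw [h10]
  have := mul_nonneg h5 (show 0 ≤ (√(1 + ‖z.2‖ ^ 2))⁻¹ * inner ℝ z.2 v + M by linarith)
  linarith

end

theorem integrable_of_continuous_of_forall_lt_norm {E : Type*} [NormedAddCommGroup E]
    {f : ℂ → E} (hf : Continuous f) {ρ : ℝ} (h : ∀ x, ρ < ‖x‖ → f x = 0) (Ω : Set ℂ) :
    IntegrableOn f Ω := by
  refine (hf.integrable_of_hasCompactSupport (HasCompactSupport.of_support_subset_isCompact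
    (isCompact_closedBall (0 : ℂ) ρ) fun x hx => ?_)).integrableOn
  by_contra hcon
  rw [mem_closedBall_zero_iff, not_le] at hcon
  exact hx (h x hcon)

theorem hasFDerivAt_slice_snd {E : Type*} [NormedAddCommGroup E] [NormedSpace ℝ E]
    {Φ : ℝ × ℂ → E} (hΦ : ContDiff ℝ ∞ Φ) (t : ℝ) (x : ℂ) :
    HasFDerivAt (fun y => Φ (t, y)) ((fderiv ℝ Φ (t, x)).comp (ContinuousLinearMap.inr ℝ ℝ ℂ)) x :=
  (hΦ.differentiable (by simp) (t, x)).hasFDerivAt.comp x (hasFDerivAt_prodMk_right t x)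

theorem hasDerivAt_slice_fst {E : Type*} [NormedAddCommGroup E] [NormedSpace ℝ E]
    {Φ : ℝ × ℂ → E} (hΦ : ContDiff ℝ ∞ Φ) (t : ℝ) (x : ℂ) :
    HasDerivAt (fun s => Φ (s, x)) (fderiv ℝ Φ (t, x) (1, 0)) t :=
  (hΦ.differentiable (by simp) (t, x)).hasFDerivAt.comp_hasDerivAt t
    ((hasDerivAt_id t).prodMk (hasDerivAt_const t x))

/-- Differentiation under the integral sign for a smooth function whose spatial support is bounded
locally uniformly in time. -/
theorem hasDerivAt_integral_of_contDiff {Φ : ℝ × ℂ → ℝ} (hΦ : ContDiff ℝ ∞ Φ) (Ω : Set ℂ)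
    {t ρ : ℝ} (hsupp : ∀ s x, |s - t| < 1 → ρ < ‖x‖ → Φ (s, x) = 0) :
    IntegrableOn (fun x => fderiv ℝ Φ (t, x) (1, 0)) Ω ∧
      HasDerivAt (fun s => ∫ x in Ω, Φ (s, x)) (∫ x in Ω, fderiv ℝ Φ (t, x) (1, 0)) t := by
  have hD : Continuous fun z => fderiv ℝ Φ z (1, 0) :=
    (hΦ.continuous_fderiv (by simp)).clm_apply continuous_const
  have hzero : ∀ s x, |s - t| < 1 → ρ < ‖x‖ → fderiv ℝ Φ (s, x) (1, 0) = 0 := by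
    intro s x hs hx
    have hd := hasDerivAt_slice_fst hΦ s x
    refine hd.unique ((hasDerivAt_const s (0 : ℝ)).congr_of_eventuallyEq ?_)
    have hopen : IsOpen {s : ℝ | |s - t| < 1} :=
      isOpen_lt (by fun_prop) continuous_const
    filter_upwards [hopen.mem_nhds hs] with s' hs' using hsupp s' x hs' hx
  obtain ⟨K, hK⟩ := ((isCompact_Icc (a := t - 1) (b := t + 1)).prod
    (isCompact_closedBall (0 : ℂ) ρ)).exists_bound_of_continuousOn hD.continuousOn
  have h0 : |t - t| < 1 := by simp
  refine hasDerivAt_integral_of_dominated_loc_of_deriv_le (𝕜 := ℝ) (s := Metric.ball t 1)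
    (F := fun s x => Φ (s, x)) (F' := fun s x => fderiv ℝ Φ (s, x) (1, 0))
    (bound := (Metric.closedBall (0 : ℂ) ρ).indicator fun _ => K)
    (Metric.ball_mem_nhds t one_pos) (Eventually.of_forall fun s => ?_) ?_ ?_ ?_ ?_ ?_
  · exact (hΦ.continuous.comp (Continuous.prodMk_right s)).aestronglyMeasurable
  · exact integrable_of_continuous_of_forall_lt_norm
      (hΦ.continuous.comp (Continuous.prodMk_right t)) (fun x hx => hsupp t x h0 hx) Ω
  · exact (hD.comp (Continuous.prodMk_right t)).aestronglyMeasurable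
  · refine Eventually.of_forall fun x s hs => ?_
    rw [Metric.mem_ball, Real.dist_eq] at hs
    by_cases hx : x ∈ Metric.closedBall (0 : ℂ) ρ
    · rw [indicator_of_mem hx]
      refine hK (s, x) ⟨?_, hx⟩
      rw [abs_lt] at hs
      constructor <;> linarith
    · rw [indicator_of_notMem hx, hzero s x hs (by simpa using hx), norm_zero]
  · exact ((integrable_indicator_iff measurableSet_closedBall).2
      (integrableOn_const (measure_closedBall_lt_top).ne)).integrableOn
  · exact Eventually.of_forall fun x s _ => hasDerivAt_slice_fst hΦ s x

/-- The localized integral of a nonnegative function of the vorticity does not increase. -/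
theorem integral_travellingCutoff_mul_le {F : ℝ × ℂ → ℂ} (hF : ContDiff ℝ ∞ F) {Ω : Set ℂ}
    (hΩ : MeasurableSet Ω) {τ M : ℝ} (hτ : 0 ≤ τ) (R : ℝ) (hM0 : 0 ≤ M)
    (hM : ∀ t ∈ Ioo 0 τ, ∀ x ∈ Ω, ‖F (t, x)‖ ≤ M)
    (htr : ∀ t ∈ Ioo 0 τ, ∀ x ∈ Ω, fderiv ℝ (spaceCurl F) (t, x) (1, F (t, x)) = 0)
    (htan : ∀ t ∈ Ioo 0 τ, ∀ φ : ℂ → ℝ, ContDiff ℝ ∞ φ → HasCompactSupport φ →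
      ∫ x in Ω, fderiv ℝ φ x (F (t, x)) = 0)
    {G : ℝ → ℝ} (hG : ContDiff ℝ ∞ G) (hG0 : ∀ s, 0 ≤ G s) :
    ∫ x in Ω, travellingCutoff M R (τ, x) * G (spaceCurl F (τ, x)) ≤
      ∫ x in Ω, travellingCutoff M R (0, x) * G (spaceCurl F (0, x)) := by
  set Φ : ℝ × ℂ → ℝ := fun z => travellingCutoff M R z * G (spaceCurl F z) with hΦdef
  have hW := contDiff_spaceCurl hF
  have hGW : ContDiff ℝ ∞ fun z => G (spaceCurl F z) := hG.comp hW
  have hΦ : ContDiff ℝ ∞ Φ := (contDiff_travellingCutoff M R).mul hGW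
  have hsupp : ∀ t s x, |s - t| < 1 → R + 1 - M * (t - 1) < ‖x‖ → Φ (s, x) = 0 := by
    intro t s x hs hx
    have h1 : M * (t - 1) ≤ M * s := by
      have := (abs_lt.1 hs).1
      gcongr
      linarith
    rw [hΦdef]
    simp only
    rw [travellingCutoff_eq_zero (by simp only; linarith), zero_mul]
  have hder : ∀ t, HasDerivAt (fun s => ∫ x in Ω, Φ (s, x))
      (∫ x in Ω, fderiv ℝ Φ (t, x) (1, 0)) t :=
    fun t => (hasDerivAt_integral_of_contDiff hΦ Ω (hsupp t)).2
  have hanti : AntitoneOn (fun s => ∫ x in Ω, Φ (s, x)) (Icc 0 τ) := by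
    refine antitoneOn_of_deriv_nonpos (convex_Icc 0 τ)
      (fun t _ => (hder t).continuousAt.continuousWithinAt)
      (fun t _ => (hder t).differentiableAt.differentiableWithinAt) fun t ht => ?_
    rw [interior_Icc] at ht
    rw [(hder t).deriv]
    have hzero : ∀ x, R + 1 - M * (t - 1) < ‖x‖ → Φ (t, x) = 0 :=
      fun x hx => hsupp t t x (by simp) hx
    have hφ : ContDiff ℝ ∞ fun x => Φ (t, x) := hΦ.comp (contDiff_prodMk_right t)
    have hφc : HasCompactSupport fun x => Φ (t, x) := by
      refine HasCompactSupport.of_support_subset_isCompact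
        (isCompact_closedBall (0 : ℂ) (R + 1 - M * (t - 1))) fun x hx => ?_
      by_contra hcon
      rw [mem_closedBall_zero_iff, not_le] at hcon
      exact hx (hzero x hcon)
    have hslice : ∀ x, fderiv ℝ (fun y => Φ (t, y)) x (F (t, x))
        = fderiv ℝ Φ (t, x) (0, F (t, x)) := fun x => by
      rw [(hasFDerivAt_slice_snd hΦ t x).fderiv]
      simp
    have h0 := htan t ht _ hφ hφc
    have hint1 := (hasDerivAt_integral_of_contDiff hΦ Ω (hsupp t)).1
    have hint2 : IntegrableOn (fun x => fderiv ℝ (fun y => Φ (t, y)) x (F (t, x))) Ω := by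
      refine integrable_of_continuous_of_forall_lt_norm (ρ := R + 1 - M * (t - 1)) ?_ ?_ Ω
      · exact (hφ.continuous_fderiv (by simp)).clm_apply
          (hF.continuous.comp (Continuous.prodMk_right t))
      · intro x hx
        have : (fun y => Φ (t, y)) =ᶠ[𝓝 x] fun _ => 0 := by
          filter_upwards [(isOpen_lt continuous_const continuous_norm).mem_nhds hx] with y hy
          exact hzero y hy
        rw [this.fderiv_eq]
        simp
    -- Tangency tested against `Φ (t, ·)` itself adds a zero advection term, which completes the
    -- time derivative to a material derivative. Since the vorticity is transported, only the cutoff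
    -- contributes to it.
    have hsum : ∫ x in Ω, fderiv ℝ Φ (t, x) (1, 0) = ∫ x in Ω, (fderiv ℝ Φ (t, x) (1, 0) +
        fderiv ℝ (fun y => Φ (t, y)) x (F (t, x))) := by
      rw [integral_add hint1 hint2, h0, add_zero]
    rw [hsum]
    refine setIntegral_nonpos hΩ fun x hx => ?_
    rw [hslice, ← map_add, Prod.mk_add_mk, add_zero, zero_add]
    have e1 := ((contDiff_travellingCutoff M R).differentiable (by simp) (t, x)).hasFDerivAt
    have e2 := (hG.differentiable (by simp) (spaceCurl F (t, x))).hasDerivAt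
    have e3 := (hW.differentiable (by simp) (t, x)).hasFDerivAt
    have e4 := e1.mul (HasDerivAt.comp_hasFDerivAt (h₂ := G) (t, x) e2 e3)
    have e5 : HasFDerivAt Φ _ (t, x) := e4
    rw [e5.fderiv]
    simp only [add_apply, smul_apply, smul_eq_mul, Function.comp_apply, htr t ht x hx, mul_zero,
      zero_add]
    exact mul_nonpos_of_nonneg_of_nonpos (hG0 _)
      (fderiv_travellingCutoff_nonpos _ (hM t ht x hx))
  exact hanti ⟨le_rfl, hτ⟩ ⟨hτ, le_rfl⟩ hτ

/-- The distribution function of the vorticity does not increase. -/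
theorem measure_lt_abs_spaceCurl_le {F : ℝ × ℂ → ℂ} (hF : ContDiff ℝ ∞ F) {Ω : Set ℂ}
    (hΩ : MeasurableSet Ω) {τ M : ℝ} (hτ : 0 ≤ τ) (hM0 : 0 ≤ M)
    (hM : ∀ t ∈ Ioo 0 τ, ∀ x ∈ Ω, ‖F (t, x)‖ ≤ M)
    (htr : ∀ t ∈ Ioo 0 τ, ∀ x ∈ Ω, fderiv ℝ (spaceCurl F) (t, x) (1, F (t, x)) = 0)
    (htan : ∀ t ∈ Ioo 0 τ, ∀ φ : ℂ → ℝ, ContDiff ℝ ∞ φ → HasCompactSupport φ →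
      ∫ x in Ω, fderiv ℝ φ x (F (t, x)) = 0) {σ : ℝ} (hσ : 0 ≤ σ) :
    volume.restrict Ω {x | σ < |spaceCurl F (τ, x)|} ≤
      volume.restrict Ω {x | σ < |spaceCurl F (0, x)|} := by
  have hWc := (contDiff_spaceCurl hF).continuous
  -- Smooth approximations from below of the indicator of `|s| > σ`. The same `j` serves as cutoff
  -- radius, and Fatou's lemma passes to the limit at time `τ`, so the initial set may have infinite
  -- measure.
  set G : ℕ → ℝ → ℝ := fun j s => Real.smoothTransition (j * (s ^ 2 - σ ^ 2)) with hGdef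
  have hG : ∀ j, ContDiff ℝ ∞ (G j) := fun j =>
    Real.smoothTransition.contDiff.comp (contDiff_const.mul ((contDiff_id.pow 2).sub contDiff_const))
  have hGzero : ∀ j s, |s| ≤ σ → G j s = 0 := by
    intro j s hs
    refine Real.smoothTransition.zero_of_nonpos (mul_nonpos_of_nonneg_of_nonpos j.cast_nonneg ?_)
    rw [sub_nonpos, sq_le_sq, abs_of_nonneg hσ]
    exact hs
  have hcont : ∀ (t : ℝ) (j : ℕ), Continuous fun x : ℂ =>
      travellingCutoff M j (t, x) * G j (spaceCurl F (t, x)) := fun t j =>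
    ((contDiff_travellingCutoff M j).continuous.comp (Continuous.prodMk_right t)).mul
      ((hG j).continuous.comp (hWc.comp (Continuous.prodMk_right t)))
  have hnn : ∀ (t : ℝ) (j : ℕ) (x : ℂ), 0 ≤ travellingCutoff M j (t, x) * G j (spaceCurl F (t, x)) :=
    fun t j x => mul_nonneg (travellingCutoff_nonneg _ _ _) (Real.smoothTransition.nonneg _)
  have hint : ∀ t (j : ℕ), IntegrableOn (fun x : ℂ =>
      travellingCutoff M j (t, x) * G j (spaceCurl F (t, x))) Ω := fun t j =>
    integrable_of_continuous_of_forall_lt_norm (hcont t j) (ρ := j + 1 - M * t)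
      (fun x hx => by rw [travellingCutoff_eq_zero hx.le, zero_mul]) Ω
  have hmeas : ∀ t, MeasurableSet {x : ℂ | σ < |spaceCurl F (t, x)|} := fun t =>
    (isOpen_lt continuous_const (hWc.comp (Continuous.prodMk_right t)).abs).measurableSet
  have hupper : ∀ j : ℕ, ∫⁻ x in Ω,
      ENNReal.ofReal (travellingCutoff M j (τ, x) * G j (spaceCurl F (τ, x))) ≤
      volume.restrict Ω {x | σ < |spaceCurl F (0, x)|} := by
    intro j
    rw [← ofReal_integral_eq_lintegral_ofReal (hint τ j) (Eventually.of_forall (hnn τ j))]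
    refine (ENNReal.ofReal_le_ofReal (integral_travellingCutoff_mul_le hF hΩ hτ j hM0 hM htr htan
      (hG j) fun s => Real.smoothTransition.nonneg _)).trans ?_
    rw [ofReal_integral_eq_lintegral_ofReal (hint 0 j) (Eventually.of_forall (hnn 0 j)),
      ← lintegral_indicator_one (hmeas 0)]
    refine lintegral_mono fun x => ?_
    by_cases hx : σ < |spaceCurl F (0, x)|
    · rw [indicator_of_mem (show x ∈ {x : ℂ | σ < |spaceCurl F (0, x)|} from hx), Pi.one_apply,
        ENNReal.ofReal_le_one]
      exact mul_le_one₀ (travellingCutoff_le_one _ _ _) (Real.smoothTransition.nonneg _)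
        (Real.smoothTransition.le_one _)
    · rw [hGzero _ _ (not_lt.1 hx), mul_zero, ENNReal.ofReal_zero]
      exact zero_le
  calc volume.restrict Ω {x | σ < |spaceCurl F (τ, x)|}
      = ∫⁻ x in Ω, {x : ℂ | σ < |spaceCurl F (τ, x)|}.indicator 1 x :=
        (lintegral_indicator_one (hmeas τ)).symm
    _ ≤ ∫⁻ x in Ω, liminf (fun j : ℕ =>
        ENNReal.ofReal (travellingCutoff M j (τ, x) * G j (spaceCurl F (τ, x)))) atTop := by
        refine lintegral_mono fun x => ?_
        by_cases hx : σ < |spaceCurl F (τ, x)|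
        · rw [indicator_of_mem (show x ∈ {x : ℂ | σ < |spaceCurl F (τ, x)|} from hx), Pi.one_apply]
          refine (Tendsto.liminf_eq (tendsto_const_nhds.congr' ?_)).ge
          have hpos : 0 < spaceCurl F (τ, x) ^ 2 - σ ^ 2 := by
            rw [sub_pos, sq_lt_sq, abs_of_nonneg hσ]
            exact hx
          filter_upwards [tendsto_natCast_atTop_atTop.eventually_ge_atTop
              (√(1 + ‖x‖ ^ 2) + M * τ),
            tendsto_natCast_atTop_atTop.eventually_ge_atTop
              (spaceCurl F (τ, x) ^ 2 - σ ^ 2)⁻¹] with j hj1 hj2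
          rw [travellingCutoff_eq_one hj1, one_mul, hGdef]
          simp only
          rw [Real.smoothTransition.one_of_one_le, ENNReal.ofReal_one]
          rwa [inv_le_iff_one_le_mul₀ hpos] at hj2
        · rw [indicator_of_notMem (show x ∉ {x : ℂ | σ < |spaceCurl F (τ, x)|} from hx)]
          exact zero_le
    _ ≤ liminf (fun j : ℕ => ∫⁻ x in Ω,
        ENNReal.ofReal (travellingCutoff M j (τ, x) * G j (spaceCurl F (τ, x)))) atTop :=
        lintegral_liminf_le fun j => (hcont τ j).measurable.ennreal_ofReal
    _ ≤ volume.restrict Ω {x | σ < |spaceCurl F (0, x)|} :=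
        (liminf_le_liminf (Eventually.of_forall hupper)).trans (liminf_const _).le

/-- Domination of distribution functions implies domination of all Lebesgue norms. -/
theorem eLpNorm_le_of_measure_lt_abs_le {α : Type*} [MeasurableSpace α] {μ : Measure α}
    {f g : α → ℝ} (hf : AEMeasurable f μ) (hg : AEMeasurable g μ)
    (h : ∀ σ : ℝ, 0 ≤ σ → μ {x | σ < |f x|} ≤ μ {x | σ < |g x|}) (q : ℝ≥0∞) :
    eLpNorm f q μ ≤ eLpNorm g q μ := by
  rcases eq_or_ne q 0 with rfl | hq0
  · simp
  rcases eq_or_ne q ⊤ with rfl | hqt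
  · rw [eLpNorm_exponent_top, eLpNorm_exponent_top]
    refine le_of_forall_gt_imp_ge_of_dense fun b hb => ?_
    rcases eq_or_ne b ⊤ with rfl | hbt
    · exact le_top
    have hset : ∀ k : α → ℝ, {x | b < ‖k x‖ₑ} = {x | b.toReal < |k x|} := fun k => by
      ext x
      simp only [mem_ofPred_eq]
      rw [← ENNReal.ofReal_toReal hbt, Real.enorm_eq_ofReal_abs, ENNReal.ofReal_lt_ofReal_iff',
        ENNReal.toReal_ofReal ENNReal.toReal_nonneg]
      exact ⟨fun h => h.1, fun h => ⟨h, ENNReal.toReal_nonneg.trans_lt h⟩⟩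
    have h1 : μ {x | b < ‖g x‖ₑ} = 0 := by
      have : ∀ᵐ x ∂μ, ‖g x‖ₑ < b := ae_lt_of_essSup_lt hb
      refine measure_mono_null (fun x hx => ?_) (ae_iff.1 this)
      exact not_lt.2 (le_of_lt hx)
    refine essSup_le_of_ae_le b ?_
    have h2 : μ {x | b < ‖f x‖ₑ} = 0 := by
      rw [hset] at h1 ⊢
      exact le_antisymm ((h _ ENNReal.toReal_nonneg).trans h1.le) zero_le
    have h3 : ∀ᵐ x ∂μ, ¬ b < ‖f x‖ₑ := by
      rw [ae_iff]
      simpa using h2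
    filter_upwards [h3] with x hx using not_lt.1 hx
  · have hqpos : 0 < q.toReal := ENNReal.toReal_pos hq0 hqt
    rw [eLpNorm_eq_lintegral_rpow_enorm_toReal hq0 hqt,
      eLpNorm_eq_lintegral_rpow_enorm_toReal hq0 hqt]
    refine ENNReal.rpow_le_rpow ?_ (by positivity)
    -- Layer-cake formula: the integral depends monotonically on the distribution function.
    have hlay : ∀ k : α → ℝ, AEMeasurable k μ → ∫⁻ x, ‖k x‖ₑ ^ q.toReal ∂μ =
        ENNReal.ofReal q.toReal * ∫⁻ t in Ioi (0 : ℝ),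
          μ {a | t < |k a|} * ENNReal.ofReal (t ^ (q.toReal - 1)) := fun k hk => by
      rw [← lintegral_rpow_eq_lintegral_meas_lt_mul μ
        (Eventually.of_forall fun x => abs_nonneg (k x)) hk.abs hqpos]
      refine lintegral_congr fun x => ?_
      rw [Real.enorm_eq_ofReal_abs, ENNReal.ofReal_rpow_of_nonneg (abs_nonneg _) hqpos.le]
    rw [hlay f hf, hlay g hg]
    gcongr ENNReal.ofReal q.toReal * ?_
    refine setLIntegral_mono' measurableSet_Ioi fun t ht => ?_
    exact mul_le_mul' (h t ht.le) le_rfl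

theorem fderiv_eq_of_eqOn_slice {E : Type*} [NormedAddCommGroup E] [NormedSpace ℝ E] {Ω : Set ℂ}
    (hΩ : IsOpen Ω) {f : ℝ → ℂ → E} {F : ℝ × ℂ → E} (hF : ContDiff ℝ ∞ F)
    (h : ∀ t, 0 ≤ t → ∀ x ∈ closure Ω, f t x = F (t, x)) {t : ℝ} (ht : 0 ≤ t) {x : ℂ}
    (hx : x ∈ Ω) (e : ℂ) : fderiv ℝ (f t) x e = fderiv ℝ F (t, x) (0, e) := by
  have : f t =ᶠ[𝓝 x] fun y => F (t, y) := by
    filter_upwards [hΩ.mem_nhds hx] with y hy using h t ht y (subset_closure hy)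
  rw [this.fderiv_eq, (hasFDerivAt_slice_snd hF t x).fderiv]
  simp

/-- All Lebesgue norms of the vorticity of a smooth Euler flow are controlled by those of the
initial vorticity. -/
theorem IsSmoothEulerFlow.eLpNorm_vorticity_le {Ω : Set ℂ} {ω₀ : ℂ → ℝ} {u : ℝ → ℂ → ℂ}
    (h : IsSmoothEulerFlow Ω ω₀ u) (hΩ : IsOpen Ω) {τ : ℝ} (hτ : 0 ≤ τ) (q : ℝ≥0∞) :
    AEStronglyMeasurable (vorticity Ω u τ) ∧
      eLpNorm (vorticity Ω u τ) q volume ≤ eLpNorm ω₀ q volume := by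
  obtain ⟨F, hF, huF⟩ := h.smooth
  obtain ⟨p, ⟨Q, hQ, hpQ⟩, hmom⟩ := h.momentum
  have hfd : ∀ t, 0 ≤ t → ∀ x ∈ Ω, ∀ e, fderiv ℝ (u t) x e = fderiv ℝ F (t, x) (0, e) :=
    fun t ht x hx e => fderiv_eq_of_eqOn_slice hΩ hF huF ht hx e
  have hcurl : ∀ t, 0 ≤ t → ∀ x ∈ Ω, curl (u t) x = spaceCurl F (t, x) := fun t ht x hx => by
    rw [curl, hfd t ht x hx, hfd t ht x hx, spaceCurl]
  set V : Set (ℝ × ℂ) := Ioi 0 ×ˢ Ω with hVdef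
  have hV : IsOpen V := isOpen_Ioi.prod hΩ
  have hmomF : ∀ z ∈ V, fderiv ℝ F z (1, F z) + gradient (p z.1) z.2 = 0 := by
    rintro ⟨t, x⟩ ⟨ht, hx⟩
    have ht' : 0 < t := ht
    have h1 := hmom t ht' x hx
    have h2 : deriv (fun s => u s x) t = fderiv ℝ F (t, x) (1, 0) := by
      have : (fun s => u s x) =ᶠ[𝓝 t] fun s => F (s, x) := by
        filter_upwards [isOpen_Ioi.mem_nhds ht] with s hs
          using huF s (le_of_lt hs) x (subset_closure hx)
      rw [this.deriv_eq, (hasDerivAt_slice_fst hF t x).deriv]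
    rw [h2, hfd t ht'.le x hx, ← map_add, huF t ht'.le x (subset_closure hx), Prod.mk_add_mk,
      add_zero, zero_add] at h1
    exact h1
  have hgrad : ∀ z ∈ V, ∀ e, inner ℝ (gradient (p z.1) z.2) e = fderiv ℝ Q z (0, e) := by
    rintro ⟨t, x⟩ ⟨ht, hx⟩ e
    rw [inner_gradient_left]
    exact fderiv_eq_of_eqOn_slice hΩ hQ hpQ (le_of_lt ht) hx e
  have htr : ∀ z ∈ V, fderiv ℝ (spaceCurl F) z (1, F z) = 0 := by
    intro z hz
    refine fderiv_spaceCurl_eq_zero hF hQ hV (fun z hz => ?_) (fun z hz => ?_) ?_ hz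
    · rw [← hgrad z hz, Complex.inner]
      simpa using congrArg Complex.re (hmomF z hz)
    · rw [← hgrad z hz, Complex.inner]
      simpa using congrArg Complex.im (hmomF z hz)
    · rintro ⟨t, x⟩ ⟨ht, hx⟩
      have := h.div_free t (le_of_lt ht) x hx
      rwa [divergence, hfd t (le_of_lt ht) x hx, hfd t (le_of_lt ht) x hx] at this
  -- The cutoff needs a finite maximal speed on `[0, τ]`: decay bounds the velocity near infinity,
  -- and compactness bounds it elsewhere.
  obtain ⟨M, hM0, hM⟩ : ∃ M, 0 ≤ M ∧ ∀ t ∈ Ioo 0 τ, ∀ x ∈ Ω, ‖F (t, x)‖ ≤ M := by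
    obtain ⟨R, hR⟩ := h.decay τ 1 one_pos
    obtain ⟨K, hK⟩ := ((isCompact_Icc (a := 0) (b := τ)).prod
      (isCompact_closedBall (0 : ℂ) R)).exists_bound_of_continuousOn hF.continuous.continuousOn
    refine ⟨max 1 K, by positivity, fun t ht x hx => ?_⟩
    rcases le_total R ‖x‖ with hc | hc
    · rw [← huF t ht.1.le x (subset_closure hx)]
      exact (hR t (Ioo_subset_Icc_self ht) x hx hc).trans (le_max_left _ _)
    · exact (hK (t, x) ⟨Ioo_subset_Icc_self ht, by simpa using hc⟩).trans (le_max_right _ _)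
  have htan : ∀ t ∈ Ioo 0 τ, ∀ φ : ℂ → ℝ, ContDiff ℝ ∞ φ → HasCompactSupport φ →
      ∫ x in Ω, fderiv ℝ φ x (F (t, x)) = 0 := by
    intro t ht φ hφ hφc
    rw [← h.tangent t ht.1.le φ hφ hφc]
    refine setIntegral_congr_fun hΩ.measurableSet fun x hx => ?_
    simp only [huF t ht.1.le x (subset_closure hx)]
  have hWc : ∀ t, Continuous fun x => spaceCurl F (t, x) := fun t =>
    (contDiff_spaceCurl hF).continuous.comp (Continuous.prodMk_right t)
  have hvort : vorticity Ω u τ = Ω.indicator fun x => spaceCurl F (τ, x) :=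
    indicator_congr fun x hx => hcurl τ hτ x hx
  rw [hvort]
  refine ⟨((hWc τ).measurable.indicator hΩ.measurableSet).aestronglyMeasurable, ?_⟩
  rw [eLpNorm_indicator_eq_eLpNorm_restrict hΩ.measurableSet]
  calc eLpNorm (fun x => spaceCurl F (τ, x)) q (volume.restrict Ω)
      ≤ eLpNorm (fun x => spaceCurl F (0, x)) q (volume.restrict Ω) :=
        eLpNorm_le_of_measure_lt_abs_le (hWc τ).aemeasurable (hWc 0).aemeasurable
          (fun σ hσ => measure_lt_abs_spaceCurl_le hF hΩ.measurableSet hτ hM0 hM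
            (fun t ht x hx => htr (t, x) ⟨ht.1, hx⟩) htan hσ) q
    _ = eLpNorm ω₀ q (volume.restrict Ω) := by
        refine eLpNorm_congr_ae ?_
        filter_upwards [ae_restrict_mem hΩ.measurableSet] with x hx
        rw [← h.initial x hx, hcurl 0 le_rfl x hx]
    _ ≤ eLpNorm ω₀ q volume := eLpNorm_mono_measure _ Measure.restrict_le_self

/-! ### The singular integral -/

/-- Convolution with `|x|⁻¹` maps `L¹ ∩ Lᵖ`, `p > 2`, into bounded functions. -/
theorem exists_forall_lintegral_mul_inv_le {p : ℝ≥0∞} (hp : 2 < p) :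
    ∃ c : ℝ≥0∞, c ≠ ⊤ ∧ ∀ (w : ℂ → ℝ), AEStronglyMeasurable w → ∀ x : ℂ,
      ∫⁻ y, ‖w y‖ₑ * ‖‖x - y‖⁻¹‖ₑ ≤ eLpNorm w 1 volume + c * eLpNorm w p volume := by
  -- Outside the unit disk the kernel is at most `1` and costs only the `L¹` norm. The singular part
  -- `k` lies in `L^q` for the conjugate exponent `q`, because `p > 2` means `q < 2`.
  set k : ℂ → ℝ := (Metric.ball (0 : ℂ) 1).indicator fun z => ‖z‖⁻¹ with hk
  have hkm : Measurable k := (measurable_norm.inv).indicator measurableSet_ball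
  have hp1 : Fact (1 ≤ p) := ⟨le_trans one_le_two hp.le⟩
  set q := ENNReal.conjExponent p with hq
  have hconj : ENNReal.HolderConjugate p q := ENNReal.HolderConjugate.conjExponent hp1.out
  have hconj' : ENNReal.HolderConjugate q p := hconj.symm
  have hq2 : q < 2 := by
    have h1 : 1 < p - 1 := by
      rw [lt_tsub_iff_right]
      norm_num
      exact hp
    have h2 : (p - 1)⁻¹ < 1 := ENNReal.inv_lt_one.2 h1
    calc q = 1 + (p - 1)⁻¹ := rfl
      _ < 1 + 1 := ENNReal.add_lt_add_left ENNReal.one_ne_top h2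
      _ = 2 := by norm_num
  have hqt : q ≠ ⊤ := (hq2.trans (by norm_num)).ne
  have hq0 : q ≠ 0 := (one_pos.trans_le (le_self_add : 1 ≤ 1 + (p - 1)⁻¹)).ne'
  have hqpos : 0 < q.toReal := ENNReal.toReal_pos hq0 hqt
  have hkq : eLpNorm k q volume ≠ ⊤ := by
    refine ((eLpNorm_lt_top_iff_lintegral_rpow_enorm_lt_top hq0 hqt).2 ?_).ne
    have hq2' : q.toReal < 2 := by
      have := (ENNReal.toReal_lt_toReal hqt (by norm_num)).2 hq2
      simpa using this
    have hint : IntegrableOn (fun z : ℂ => ‖z‖ ^ (-q.toReal)) (Metric.ball 0 1) := by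
      refine integrableOn_ball_of_norm_le_rpow (C := 1) (α := q.toReal) (by simp)
        (by simpa using hq2') (Eventually.of_forall fun z => ?_)
        (measurable_norm.pow_const _).aestronglyMeasurable
      rw [one_mul, Real.norm_of_nonneg (by positivity)]
    have hfin := hint.2
    rw [hasFiniteIntegral_iff_enorm, ← lintegral_indicator measurableSet_ball] at hfin
    refine lt_of_eq_of_lt (lintegral_congr fun z => ?_) hfin
    by_cases hz : z ∈ Metric.ball (0 : ℂ) 1
    · rw [hk, indicator_of_mem hz, indicator_of_mem hz, Real.enorm_eq_ofReal (by positivity),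
        Real.enorm_eq_ofReal (by positivity), ENNReal.ofReal_rpow_of_nonneg (by positivity)
        hqpos.le, Real.rpow_neg (norm_nonneg z), Real.inv_rpow (norm_nonneg z)]
    · rw [hk, indicator_of_notMem hz, indicator_of_notMem hz, enorm_zero,
        ENNReal.zero_rpow_of_pos hqpos]
  refine ⟨eLpNorm k q volume, hkq, fun w hw x => ?_⟩
  have hkx : Measurable fun y => k (x - y) := hkm.comp (measurable_const.sub measurable_id)
  have hpt : ∀ y, ‖w y‖ₑ * ‖‖x - y‖⁻¹‖ₑ ≤ ‖w y‖ₑ + ‖k (x - y)‖ₑ * ‖w y‖ₑ := by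
    intro y
    by_cases hy : x - y ∈ Metric.ball (0 : ℂ) 1
    · rw [hk, indicator_of_mem hy, mul_comm]
      exact le_add_self
    · refine le_trans ?_ le_self_add
      refine mul_le_of_le_one_right zero_le ?_
      rw [mem_ball_zero_iff, not_lt] at hy
      rw [Real.enorm_eq_ofReal (by positivity), ENNReal.ofReal_le_one]
      exact inv_le_one_of_one_le₀ hy
  calc ∫⁻ y, ‖w y‖ₑ * ‖‖x - y‖⁻¹‖ₑ ≤ ∫⁻ y, (‖w y‖ₑ + ‖k (x - y)‖ₑ * ‖w y‖ₑ) := lintegral_mono hpt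
    _ = eLpNorm w 1 volume + ∫⁻ y, ‖k (x - y)‖ₑ * ‖w y‖ₑ := by
        rw [lintegral_add_left' hw.enorm, eLpNorm_one_eq_lintegral_enorm]
    _ = eLpNorm w 1 volume + eLpNorm ((fun y => k (x - y)) • w) 1 volume := by
        congr 1
        rw [eLpNorm_one_eq_lintegral_enorm]
        simp only [Pi.smul_apply', smul_eq_mul, enorm_mul]
    _ ≤ eLpNorm w 1 volume + eLpNorm (fun y => k (x - y)) q volume * eLpNorm w p volume := by
        gcongr
        exact eLpNorm_smul_le_mul_eLpNorm hw hkx.aestronglyMeasurable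
    _ = eLpNorm w 1 volume + eLpNorm k q volume * eLpNorm w p volume := by
        have hinv : eLpNorm (k ∘ fun y => x - y) q volume = eLpNorm k q volume :=
          eLpNorm_comp_measurePreserving hkm.aestronglyMeasurable
            (Measure.measurePreserving_sub_left volume x)
        rw [← hinv, Function.comp_def]

theorem aestronglyMeasurable_biotSavartIntegrand {U : Set ℂ} {T : ℂ → ℂ} {w : ℂ → ℝ}
    (hU : IsOpen U) (hT : ContinuousOn T U) (hw : AEStronglyMeasurable w) (x : ℂ) :
    AEStronglyMeasurable (biotSavartIntegrand T w x) (volume.restrict U) := by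
  have hTm : AEMeasurable T (volume.restrict U) := hT.aemeasurable hU.measurableSet
  have hwm : AEMeasurable w (volume.restrict U) := hw.aemeasurable.restrict
  refine AEMeasurable.aestronglyMeasurable ?_
  unfold biotSavartIntegrand perp circleInv
  fun_prop

theorem norm_fderiv_eq_norm_deriv {T : ℂ → ℂ} {x : ℂ} (hT : DifferentiableAt ℂ T x) :
    ‖fderiv ℝ T x‖ = ‖deriv T x‖ := by
  rw [hT.hasDerivAt.complexToReal_fderiv.fderiv]
  simp [norm_smul]

/-- Uniform bound for the Biot-Savart integral outside a disk containing the obstacle. -/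
theorem exists_forall_norm_biotSavart_le {r R d : ℝ} (hr : 0 < r) (hR : r < R) (hd : 0 < d)
    {p : ℝ≥0∞} (hp : 2 < p) :
    ∃ C₀ : ℝ → ℝ → ℝ, (∀ a b, 0 ≤ a → 0 ≤ b → 0 ≤ C₀ a b) ∧
      ∀ (U : Set ℂ) (T : ℂ → ℂ), IsOpen U → Uᶜ ⊆ Metric.closedBall 0 r →
      IsExteriorRiemannMap U T → (∃ q₁ ∉ U, ∃ q₂ ∉ U, d ≤ dist q₁ q₂) →
      ∀ (w : ℂ → ℝ) (a b : ℝ≥0∞), AEStronglyMeasurable w → a ≠ ⊤ → b ≠ ⊤ →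
      eLpNorm w 1 volume ≤ a → eLpNorm w p volume ≤ b → ∀ x, R ≤ ‖x‖ →
      IntegrableOn (biotSavartIntegrand T w x) U ∧
        ‖biotSavart U T w x‖ ≤ C₀ a.toReal b.toReal := by
  obtain ⟨A, hA0, hA⟩ := exists_forall_norm_deriv_le hr hR hd
  obtain ⟨M, hM0, hM⟩ := exists_forall_norm_biotSavartIntegrand_le hr hR
  obtain ⟨c, hc, hcw⟩ := exists_forall_lintegral_mul_inv_le hp
  refine ⟨fun a b => A * (M * (a + c.toReal * b + a)), fun a b ha hb => by positivity, ?_⟩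
  intro U T hU hUc hT hq w a b hw ha hb hwa hwb x hx
  have hpt : ∀ y ∈ U, ‖biotSavartIntegrand T w x y‖ₑ ≤
      ENNReal.ofReal M * (‖w y‖ₑ * ‖‖x - y‖⁻¹‖ₑ + ‖w y‖ₑ) := by
    intro y hy
    have h1 := hM U T hU hUc hT w x y hx hy
    rw [← ofReal_norm]
    refine (ENNReal.ofReal_le_ofReal h1).trans (le_of_eq ?_)
    rw [ENNReal.ofReal_mul hM0.le, mul_add, mul_one,
      ENNReal.ofReal_add (by positivity) (by positivity), ENNReal.ofReal_mul (norm_nonneg _),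
      ofReal_norm, Real.enorm_eq_ofReal (r := ‖x - y‖⁻¹) (by positivity)]
  have hle : ∫⁻ y in U, ‖biotSavartIntegrand T w x y‖ₑ ≤
      ENNReal.ofReal M * (a + c * b + a) := by
    calc ∫⁻ y in U, ‖biotSavartIntegrand T w x y‖ₑ
        ≤ ∫⁻ y in U, ENNReal.ofReal M * (‖w y‖ₑ * ‖‖x - y‖⁻¹‖ₑ + ‖w y‖ₑ) :=
          setLIntegral_mono' hU.measurableSet hpt
      _ ≤ ∫⁻ y, ENNReal.ofReal M * (‖w y‖ₑ * ‖‖x - y‖⁻¹‖ₑ + ‖w y‖ₑ) :=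
          setLIntegral_le_lintegral _ _
      _ = ENNReal.ofReal M * ((∫⁻ y, ‖w y‖ₑ * ‖‖x - y‖⁻¹‖ₑ) + eLpNorm w 1 volume) := by
          rw [lintegral_const_mul' _ _ ENNReal.ofReal_ne_top, lintegral_add_right' _ hw.enorm,
            eLpNorm_one_eq_lintegral_enorm]
      _ ≤ ENNReal.ofReal M * (a + c * b + a) := by
          gcongr
          refine (hcw w hw x).trans ?_
          gcongr
  have hfin : ENNReal.ofReal M * (a + c * b + a) ≠ ⊤ :=
    ENNReal.mul_ne_top ENNReal.ofReal_ne_top (ENNReal.add_ne_top.2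
      ⟨ENNReal.add_ne_top.2 ⟨ha, ENNReal.mul_ne_top hc hb⟩, ha⟩)
  refine ⟨⟨aestronglyMeasurable_biotSavartIntegrand hU hT.holo.continuousOn hw x,
    hle.trans_lt hfin.lt_top⟩, ?_⟩
  have hxU : x ∈ U := mem_of_compl_subset_closedBall hUc (by rw [sub_zero]; linarith)
  have hI : ‖∫ y in U, biotSavartIntegrand T w x y‖ ≤
      M * (a.toReal + c.toReal * b.toReal + a.toReal) := by
    refine (norm_integral_le_lintegral_norm _).trans ?_
    refine (ENNReal.toReal_mono hfin ?_).trans (le_of_eq ?_)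
    · simpa only [ofReal_norm] using hle
    · rw [ENNReal.toReal_mul, ENNReal.toReal_ofReal hM0.le,
        ENNReal.toReal_add (ENNReal.add_ne_top.2 ⟨ha, ENNReal.mul_ne_top hc hb⟩) ha,
        ENNReal.toReal_add ha (ENNReal.mul_ne_top hc hb), ENNReal.toReal_mul]
  have hπ : 1 / (2 * Real.pi) ≤ 1 := by
    rw [div_le_one (by positivity)]
    linarith [Real.pi_gt_three]
  rw [biotSavart, norm_smul, Real.norm_of_nonneg (by positivity)]
  refine (mul_le_of_le_one_left (norm_nonneg _) hπ).trans ?_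
  refine (ContinuousLinearMap.le_opNorm _ _).trans ?_
  rw [LinearIsometryEquiv.norm_map,
    norm_fderiv_eq_norm_deriv (hT.holo.differentiableAt (hU.mem_nhds hxU))]
  exact mul_le_mul (hA U T hU hUc hT hq x hx) hI (norm_nonneg _) hA0.le

/-! ### The unbounded component -/

/-- Polar coordinates present the set as a continuous image of a half-plane. -/
theorem isPreconnected_lt_norm_sub (c : ℂ) (ρ : ℝ) :
    IsPreconnected {z : ℂ | ρ < ‖z - c‖} := by
  have himg : {z : ℂ | ρ < ‖z - c‖} =
      (fun s : ℝ × ℝ => c + s.1 * Complex.exp (s.2 * Complex.I)) '' (Ioi ρ ×ˢ univ) := by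
    ext z
    constructor
    · intro hz
      refine ⟨(‖z - c‖, Complex.arg (z - c)), ⟨hz, mem_univ _⟩, ?_⟩
      simp only [Complex.norm_mul_exp_arg_mul_I]
      ring
    · rintro ⟨⟨s, θ⟩, ⟨hs, -⟩, rfl⟩
      have hs' : ρ < s := hs
      simp only [mem_ofPred_eq, add_sub_cancel_left, norm_mul, Complex.norm_exp_ofReal_mul_I,
        mul_one, Complex.norm_real]
      exact hs'.trans_le (le_abs_self s)
  rw [himg]
  exact (isPreconnected_Ioi.prod isPreconnected_univ).image _ (by fun_prop)

theorem not_isBounded_lt_norm_sub (c : ℂ) (ρ : ℝ) :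
    ¬ Bornology.IsBounded {z : ℂ | ρ < ‖z - c‖} := by
  intro h
  have h1 : Bornology.IsBounded {z : ℂ | ρ < ‖z - c‖}ᶜ := by
    refine (Metric.isBounded_closedBall (x := c) (r := ρ)).subset fun z hz => ?_
    rw [mem_closedBall_iff_norm]
    exact not_lt.1 hz
  have h2 := h.union h1
  rw [union_compl_self] at h2
  exact NormedSpace.unbounded_univ ℝ ℂ h2

/-- The exterior of the disk is connected, unbounded and disjoint from `C`, so each of its points
has an unbounded component. Filling the holes of `C` does not leave the disk. -/
theorem compl_unboundedComponent_subset {C : Set ℂ} {c : ℂ} {ρ : ℝ}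
    (hC : C ⊆ Metric.closedBall c ρ) : (unboundedComponent Cᶜ)ᶜ ⊆ Metric.closedBall c ρ := by
  intro z hz
  by_contra hcon
  rw [mem_closedBall_iff_norm, not_le] at hcon
  have hsub : {z : ℂ | ρ < ‖z - c‖} ⊆ Cᶜ := fun y hy hyC => by
    have h1 := hC hyC
    have h2 : ρ < ‖y - c‖ := hy
    rw [mem_closedBall_iff_norm] at h1
    linarith
  refine hz ⟨hsub hcon, fun hb => not_isBounded_lt_norm_sub c ρ (hb.subset ?_)⟩
  exact (isPreconnected_lt_norm_sub c ρ).subset_connectedComponentIn hcon hsub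

theorem isOpen_unboundedComponent {U : Set ℂ} (hU : IsOpen U) :
    IsOpen (unboundedComponent U) := by
  rw [isOpen_iff_mem_nhds]
  rintro z ⟨hz, hzb⟩
  filter_upwards [hU.connectedComponentIn.mem_nhds (mem_connectedComponentIn hz)] with y hy
  refine ⟨connectedComponentIn_subset _ _ hy, ?_⟩
  rwa [← connectedComponentIn_eq hy]

theorem notMem_unboundedComponent_compl {C : Set ℂ} {z : ℂ} (hz : z ∈ C) :
    z ∉ unboundedComponent Cᶜ := fun h => h.1 hz

end ExteriorEuler

/-! ### Uniform geometry of the obstacles and conclusion. -/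

theorem mainTheorem6
    -- the obstacle, its exterior conformal map, the exponent and the radius
    (C : Set ℂ) (hC_compact : IsCompact C) (hC_conn : IsConnected C)
    (hC_cap : 0 < ExteriorEuler.sobolevCapacity C)
    (T : ℂ → ℂ)
    (hT : ExteriorEuler.IsExteriorRiemannMap (ExteriorEuler.unboundedComponent Cᶜ) T)
    (p : ℝ≥0∞) (hp : 2 < p)
    (R₀ : ℝ) (hR₀ : C ⊆ Metric.ball 0 R₀) :
    ∃ C₀ : ℝ → ℝ → ℝ,
      ∀ (ω₀ : ℂ → ℝ),
        MemLp ω₀ 1 (volume.restrict Cᶜ) → MemLp ω₀ p (volume.restrict Cᶜ) →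
      -- the approximate obstacles and their conformal maps
      ∀ (O : ℕ → Set ℂ) (Tn : ℕ → ℂ → ℂ),
        (∀ n, ExteriorEuler.IsSmoothJordanDomain (O n)) →
        Tendsto (fun n => Metric.hausdorffDist (closure (O n)) C) atTop (𝓝 0) →
        (∀ n, ExteriorEuler.IsExteriorRiemannMap (closure (O n))ᶜ (Tn n)) →
      -- the approximate initial vorticities and the smooth flows they generate
      ∀ (ω₀n : ℕ → ℂ → ℝ) (u : ℕ → ℝ → ℂ → ℂ),
        (∀ n, ContDiff ℝ ∞ (ω₀n n)) →
        (∀ n, HasCompactSupport (ω₀n n)) →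
        (∀ n, tsupport (ω₀n n) ⊆ (closure (O n))ᶜ) →
        (∀ n, eLpNorm (ω₀n n) 1 volume ≤ eLpNorm ω₀ 1 (volume.restrict Cᶜ)) →
        (∀ n, eLpNorm (ω₀n n) p volume ≤ eLpNorm ω₀ p (volume.restrict Cᶜ)) →
        (∀ n, ExteriorEuler.IsSmoothEulerFlow (closure (O n))ᶜ (ω₀n n) (u n)) →
      -- the bound for the limit conformal map
      (∀ n : ℕ, ∀ t : ℝ, 0 ≤ t → ∀ x : ℂ, R₀ ≤ ‖x‖ →
        IntegrableOn (ExteriorEuler.biotSavartIntegrand T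
            (ExteriorEuler.vorticity (closure (O n))ᶜ (u n) t) x)
          (ExteriorEuler.unboundedComponent Cᶜ) volume ∧
        ‖ExteriorEuler.biotSavart (ExteriorEuler.unboundedComponent Cᶜ) T
            (ExteriorEuler.vorticity (closure (O n))ᶜ (u n) t) x‖
          ≤ C₀ (eLpNorm ω₀ 1 (volume.restrict Cᶜ)).toReal
              (eLpNorm ω₀ p (volume.restrict Cᶜ)).toReal) ∧
      -- the bound for the approximate rotational velocities
      (∀ K : Set ℂ, IsCompact K → Disjoint K (Metric.closedBall 0 R₀) →
        ∃ N : ℕ, ∀ n ≥ N, K ⊆ (closure (O n))ᶜ ∧ ∀ t : ℝ, 0 ≤ t → ∀ x ∈ K,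
          IntegrableOn (ExteriorEuler.biotSavartIntegrand (Tn n)
              (ExteriorEuler.vorticity (closure (O n))ᶜ (u n) t) x)
            (closure (O n))ᶜ volume ∧
          ‖ExteriorEuler.biotSavart (closure (O n))ᶜ (Tn n)
              (ExteriorEuler.vorticity (closure (O n))ᶜ (u n) t) x‖
            ≤ 2 * C₀ (eLpNorm ω₀ 1 (volume.restrict Cᶜ)).toReal
                (eLpNorm ω₀ p (volume.restrict Cᶜ)).toReal + 1) := by
  have hne := hC_conn.nonempty
  have hR₀pos : 0 < R₀ := by
    obtain ⟨z, hz⟩ := hne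
    exact (norm_nonneg z).trans_lt (by simpa using hR₀ hz)
  obtain ⟨r, hr0, hrR, hCr⟩ : ∃ r, 0 < r ∧ r < R₀ ∧ C ⊆ Metric.closedBall 0 r := by
    obtain ⟨z, hz, hmax⟩ := hC_compact.exists_isMaxOn hne continuous_norm.continuousOn
    refine ⟨max ‖z‖ (R₀ / 2), lt_max_of_lt_right (by positivity),
      max_lt (by simpa using hR₀ hz) (by linarith), fun y hy => ?_⟩
    rw [mem_closedBall_zero_iff]
    exact (hmax hy).trans (le_max_left _ _)
  have hUnb := ExteriorEuler.isOpen_unboundedComponent hC_compact.isClosed.isOpen_compl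
  -- A one-point obstacle admits no exterior Riemann map. The distance of these two points is the
  -- lower size bound on the obstacle.
  obtain ⟨q₁, hq₁, q₂, hq₂, hq⟩ : C.Nontrivial := by
    by_contra hcon
    obtain ⟨q, hq⟩ := hne
    have hsub : C ⊆ Metric.closedBall q 0 := fun z hz => by
      rw [Set.not_nontrivial_iff.1 hcon hz hq]
      exact Metric.mem_closedBall_self le_rfl
    have := ExteriorEuler.compl_unboundedComponent_subset hsub
    rw [Metric.closedBall_zero] at this
    exact hT.not_compl_subset_singleton hUnb this
  have hd : 0 < dist q₁ q₂ := dist_pos.2 hq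
  -- The gap between `r` and `r'`, and the halving of the distance below, leave room for Hausdorff
  -- perturbations of `C`.
  obtain ⟨r', hrr', hr'R⟩ := exists_between hrR
  have hr'0 : 0 < r' := hr0.trans hrr'
  obtain ⟨C₀, hC₀, hbound⟩ := ExteriorEuler.exists_forall_norm_biotSavart_le hr'0 hr'R
    (half_pos hd) hp
  refine ⟨C₀, fun ω₀ hω1 hωp O Tn hO hconv hTn ω₀n u _ _ _ hn1 hnp hflow => ⟨?_, ?_⟩⟩
  · intro n t ht x hx
    obtain ⟨hm, h1⟩ := (hflow n).eLpNorm_vorticity_le isClosed_closure.isOpen_compl ht 1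
    obtain ⟨-, h2⟩ := (hflow n).eLpNorm_vorticity_le isClosed_closure.isOpen_compl ht p
    exact hbound _ T hUnb
      (ExteriorEuler.compl_unboundedComponent_subset
        (hCr.trans (Metric.closedBall_subset_closedBall hrr'.le))) hT
      ⟨q₁, ExteriorEuler.notMem_unboundedComponent_compl hq₁, q₂,
        ExteriorEuler.notMem_unboundedComponent_compl hq₂, by linarith⟩ _ _ _ hm
      hω1.2.ne hωp.2.ne (h1.trans (hn1 n)) (h2.trans (hnp n)) x hx
  · intro K _ hKdisj
    -- The first entry puts `closure (O n)` in the disk of radius `r'`. The second moves each of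
    -- `q₁`, `q₂` by less than a quarter of their distance, so half of it survives.
    have hε : 0 < min (r' - r) (dist q₁ q₂ / 4) := lt_min (sub_pos.2 hrr') (by positivity)
    obtain ⟨N, hN⟩ := eventually_atTop.1 (hconv.eventually (gt_mem_nhds hε))
    refine ⟨N, fun n hn => ?_⟩
    have hdist := hN n hn
    have hfin : Metric.hausdorffEDist (closure (O n)) C ≠ ⊤ :=
      Metric.hausdorffEDist_ne_top_of_nonempty_of_bounded (hO n).2.1.nonempty.closure hne
        (hO n).2.2.1.closure hC_compact.isBounded
    have hsub : closure (O n) ⊆ Metric.closedBall 0 r' := by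
      intro z hz
      obtain ⟨y, hy, hzy⟩ := Metric.exists_dist_lt_of_hausdorffDist_lt hz
        (hdist.trans_le (min_le_left _ _)) hfin
      have h1 := hCr hy
      rw [Metric.mem_closedBall] at h1 ⊢
      linarith [dist_triangle z y 0]
    have hKout : ∀ x ∈ K, R₀ < ‖x‖ := fun x hx => by
      have := Set.disjoint_left.1 hKdisj hx
      simpa using this
    refine ⟨fun x hx hxO => ?_, fun t ht x hx => ?_⟩
    · have h1 := hsub hxO
      rw [mem_closedBall_zero_iff] at h1
      linarith [hKout x hx]
    obtain ⟨p₁, hp₁, hd₁⟩ := Metric.exists_dist_lt_of_hausdorffDist_lt' hq₁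
      (hdist.trans_le (min_le_right _ _)) hfin
    obtain ⟨p₂, hp₂, hd₂⟩ := Metric.exists_dist_lt_of_hausdorffDist_lt' hq₂
      (hdist.trans_le (min_le_right _ _)) hfin
    have hp₁₂ : dist q₁ q₂ / 2 ≤ dist p₁ p₂ := by
      rw [dist_comm p₁ q₁] at hd₁
      linarith [dist_triangle4 q₁ p₁ p₂ q₂]
    obtain ⟨hm, h1⟩ := (hflow n).eLpNorm_vorticity_le isClosed_closure.isOpen_compl ht 1
    obtain ⟨-, h2⟩ := (hflow n).eLpNorm_vorticity_le isClosed_closure.isOpen_compl ht p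
    obtain ⟨hint, hle⟩ := hbound _ (Tn n) isClosed_closure.isOpen_compl
      (by rwa [compl_compl]) (hTn n)
      ⟨p₁, not_not.2 hp₁, p₂, not_not.2 hp₂, hp₁₂⟩ _ _ _ hm
      hω1.2.ne hωp.2.ne (h1.trans (hn1 n)) (h2.trans (hnp n)) x (hKout x hx).le
    refine ⟨hint, hle.trans ?_⟩
    -- The bound obtained is `C₀` itself; nonnegativity of `C₀` weakens it to `2 C₀ + 1`.
    linarith [hC₀ _ _ (ENNReal.toReal_nonneg (a := eLpNorm ω₀ 1 (volume.restrict Cᶜ)))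
      (ENNReal.toReal_nonneg (a := eLpNorm ω₀ p (volume.restrict Cᶜ)))]
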